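/- Lemma (unique solvability of the stabilizer-free weak Galerkin scheme). Let $\Omega\subset\mathbb{R}^d$, $d\ge 2$, be a bounded polytopal domain (open, connected, with $\operatorname{int}\overline\Omega=\Omega$), and let $\mathcal{T}_h$ be a finite partition of $\Omega$ into convex polytopes $T$ (polygons for $d=2$, polyhedra for $d=3$): the elements have pairwise disjoint interiors, their union is $\overline\Omega$, and every facet (edge if $d=2$, flat face if $d=3$) of an element either lies on $\partial\Omega$ or is also a facet of another element. Let $\mathcal{E}_h$ be the set of all facets, and for each $e\in\mathcal{E}_h$ fix a unit vector $\mathbf{n}_e$ normal to $e$; $\mathbf{n}$ denotes the outward unit normal on $\partial T$. Write $P_m(K)$ for the polynomials of degree at most $m$ on $K$, $(\cdot,\cdot)_T$ and $\langle\cdot,\cdot\rangle_{\partial T}$ for the $L^2$ inner products on $T$ and $\partial T$, and let $k\ge 2$. Put $$V_h=\{v=\{v_0,v_b,v_n\mathbf{n}_e\}:\ v_0|_T\in P_k(T)\ (T\in\mathcal{T}_h),\ v_b|_e\in P_k(e),\ v_n|_e\in P_{k-1}(e)\ (e\in\mathcal{E}_h)\},$$ and let $V_h^0$ be the subspace of those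 $v$ with $v_b|_e=0$ and $v_n\mathbf{n}_e\cdot\mathbf{n}|_e=0$ for all $e\subset\partial\Omega$. Let $j$ be an integer with $j\ge k+2n_T-1$ for every $T\in\mathcal{T}_h$, where $n_T$ is the number of facets of $T$. For $v\in V_h$ the weak Laplacian $\Delta_w v|_T\in P_j(T)$ is defined by $$(\Delta_w v,\varphi)_T=(v_0,\Delta\varphi)_T-\langle v_b,\nabla\varphi\cdot\mathbf{n}\rangle_{\partial T}+\langle v_n\mathbf{n}_e\cdot\mathbf{n},\varphi\rangle_{\partial T}\qquad\forall\varphi\in P_j(T).$$ Let $f\in L^2(\Omega)$ and $g,\phi\in L^2(\partial\Omega)$, and let $Q_b$, $Q_n$ be the $L^2(e)$ projections onto $P_k(e)$ and $P_{k-1}(e)$. Then $\Delta_w v$ is well defined, that is, for every $v\in V_h$ and $T\in\mathcal{T}_h$ exactly one polynomial in $P_j(T)$ satisfies the equation above; and there is exactly one $u_h=\{u_0,u_b,u_n\mathbf{n}_e\}\in V_h$ with $u_b=Q_bg$ and $u_n\mathbf{n}_e\cdot\mathbf{n}=Q_n\phi$ on every $e\subset\partial\Omega$ such that $$\sum_{T\in\mathcal{T}_h}(\Delta_w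 u_h,\Delta_w v)_T=\sum_{T\in\mathcal{T}_h}(f,v_0)_T\qquad\forall v=\{v_0,v_b,v_n\mathbf{n}_e\}\in V_h^0.$$ -/

import Mathlib

open MeasureTheory

noncomputable section

namespace WG

/-- The Euclidean space `ℝ^d`. -/
abbrev E (d : ℕ) : Type := EuclideanSpace ℝ (Fin d)

/-! ### Polynomials -/

/-- Polynomials in `d` variables of total degree at most `m`. As an element `T` of a partition has
nonempty interior, this is also the space `P_m(T)`. -/
abbrev Poly (d m : ℕ) : Submodule ℝ (MvPolynomial (Fin d) ℝ) :=
  MvPolynomial.restrictTotalDegree (Fin d) ℝ m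

/-- The value of a polynomial at a point. -/
def pval {d : ℕ} (p : MvPolynomial (Fin d) ℝ) (x : E d) : ℝ :=
  MvPolynomial.eval (fun i => x i) p

/-- The Laplacian `Δp`. -/
def lap {d : ℕ} (p : MvPolynomial (Fin d) ℝ) : MvPolynomial (Fin d) ℝ :=
  ∑ i, MvPolynomial.pderiv i (MvPolynomial.pderiv i p)

/-- The directional derivative `∇p · n` at `x`. -/
def dirDeriv {d : ℕ} (p : MvPolynomial (Fin d) ℝ) (n x : E d) : ℝ :=
  ∑ i, pval (MvPolynomial.pderiv i p) x * n i

/-- Restriction of polynomials to a set `e`, as a linear map. -/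
def restrictTo {d : ℕ} (e : Set (E d)) : MvPolynomial (Fin d) ℝ →ₗ[ℝ] (e → ℝ) where
  toFun p := fun x => pval p x
  map_add' p q := by funext x; simp [pval]
  map_smul' c p := by funext x; simp [pval, MvPolynomial.smul_eval]

/-- `P_m(e)`: the functions on `e` that are restrictions of polynomials of degree at most `m`. -/
def PolyOn {d : ℕ} (m : ℕ) (e : Set (E d)) : Submodule ℝ (e → ℝ) :=
  (Poly d m).map (restrictTo e)

/-- The surface measure `ds` in `ℝ^d`: the `(d-1)`-dimensional Hausdorff measure, normalised so
that it agrees with Lebesgue measure on hyperplanes. -/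
def surf (d : ℕ) : Measure (E d) := μHE[d - 1]

/-- The surface measure on `e`. -/
def surfOn {d : ℕ} (e : Set (E d)) : Measure e := (surf d).comap Subtype.val

/-- `q` is the `L²(e)` projection of `g` onto `P_m(e)`. -/
def IsL2Projection {d : ℕ} (m : ℕ) (e : Set (E d)) (g : E d → ℝ) (q : e → ℝ) : Prop :=
  q ∈ PolyOn m e ∧
    ∀ p ∈ PolyOn m e, ∫ x, q x * p x ∂(surfOn e) = ∫ x, g x * p x ∂(surfOn e)

/-! ### Polytopes and partitions -/

/-- A convex polytope (polygon, polyhedron) of full dimension in `ℝ^d`, given by its facets: it is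
the bounded set `{x | ⟪ν_i, x⟫ ≤ b_i for all i}` with nonempty interior, where the `ν_i` are unit
vectors and no inequality is redundant. -/
structure ConvexPolytope (d : ℕ) where
  /-- the number of facets (edges if `d = 2`, flat faces if `d = 3`) -/
  n : ℕ
  /-- the outward unit normals of the facets -/
  normal : Fin n → E d
  /-- the offsets of the facets -/
  offset : Fin n → ℝ
  norm_normal : ∀ i, ‖normal i‖ = 1
  bounded : Bornology.IsBounded {x : E d | ∀ i, inner ℝ (normal i) x ≤ offset i}
  nonempty_interior : (interior {x : E d | ∀ i, inner ℝ (normal i) x ≤ offset i}).Nonempty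
  /-- each facet has a relative interior point, at which only its own constraint is active -/
  irredundant : ∀ i, ∃ x : E d, inner ℝ (normal i) x = offset i ∧
    ∀ j, j ≠ i → inner ℝ (normal j) x < offset j

/-- The polytope as a set. -/
def ConvexPolytope.carrier {d : ℕ} (T : ConvexPolytope d) : Set (E d) :=
  {x | ∀ i, inner ℝ (T.normal i) x ≤ T.offset i}

/-- The `i`-th facet. -/
def ConvexPolytope.facet {d : ℕ} (T : ConvexPolytope d) (i : Fin T.n) : Set (E d) :=
  {x | x ∈ T.carrier ∧ inner ℝ (T.normal i) x = T.offset i}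

/-- A partition `𝒯_h` of `Ω` into convex polytopes, indexed by `ι`: the elements have disjoint
interiors, they fill `Ω` up to its boundary, and each facet of an element lies on `∂Ω` or is also
a facet of another element. -/
structure Mesh {d : ℕ} (Ω : Set (E d)) (ι : Type*) where
  /-- the elements -/
  elem : ι → ConvexPolytope d
  disjoint : Pairwise fun a b => Disjoint (interior (elem a).carrier) (interior (elem b).carrier)
  cover : closure Ω = ⋃ a, (elem a).carrier
  conforming : ∀ a i, (elem a).facet i ⊆ frontier Ω ∨
    ∃ b, b ≠ a ∧ ∃ i', (elem b).facet i' = (elem a).facet i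

/-- A bounded domain that lies on one side of its boundary (so it has no slits). With a `Mesh` on
it, it is a bounded polytopal domain. -/
structure IsBoundedDomain {d : ℕ} (Ω : Set (E d)) : Prop where
  isOpen : IsOpen Ω
  isConnected : IsConnected Ω
  isBounded : Bornology.IsBounded Ω
  regular : interior (closure Ω) = Ω

section Scheme

variable {d : ℕ} {Ω : Set (E d)} {ι : Type*}

/-- `ℰ_h`: the set of all edges or flat faces of the partition. -/
def Mesh.Face (M : Mesh Ω ι) : Type :=
  {e : Set (E d) // ∃ a i, (M.elem a).facet i = e}

/-- The `i`-th facet of the element `a`, as a member of `ℰ_h`. -/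
def Mesh.face (M : Mesh Ω ι) (a : ι) (i : Fin (M.elem a).n) : M.Face :=
  ⟨(M.elem a).facet i, a, i, rfl⟩

/-- `n_e` is, for each `e ∈ ℰ_h`, a unit vector normal to `e`: a choice of the set `𝒟_h`. -/
def Mesh.IsNormalField (M : Mesh Ω ι) (ne : M.Face → E d) : Prop :=
  ∀ e : M.Face, ‖ne e‖ = 1 ∧ ∀ x ∈ e.1, ∀ y ∈ e.1, inner ℝ (ne e) (x - y) = 0

/-- The weak Galerkin space `V_h`: triples `v = (v_0, v_b, v_n)`, standing for
`{v_0, v_b, v_n n_e}`, with `v_0 ∈ P_k(T)` on each element `T`, and `v_b ∈ P_k(e)`,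
`v_n ∈ P_{k-1}(e)` on each `e ∈ ℰ_h`. -/
abbrev Mesh.V (M : Mesh Ω ι) (k : ℕ) : Type _ :=
  (ι → Poly d k) × ((e : M.Face) → PolyOn k e.1) × ((e : M.Face) → PolyOn (k - 1) e.1)

variable (M : Mesh Ω ι) {k : ℕ} (ne : M.Face → E d)

/-- The component `v_0` on the element `a`. -/
def Mesh.v0 (v : M.V k) (a : ι) : MvPolynomial (Fin d) ℝ := v.1 a

/-- The component `v_b` on `e`. -/
def Mesh.vb (v : M.V k) (e : M.Face) : e.1 → ℝ := v.2.1 e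

/-- The function `v_n` on `e`. -/
def Mesh.vn (v : M.V k) (e : M.Face) : e.1 → ℝ := v.2.2 e

/-- The function `v_n n_e · n` on the `i`-th facet of the element `a`, with `n` the outward unit
normal of this element. -/
def Mesh.vnn (v : M.V k) (a : ι) (i : Fin (M.elem a).n) : (M.face a i).1 → ℝ :=
  fun x => M.vn v (M.face a i) x * inner ℝ (ne (M.face a i)) ((M.elem a).normal i)

/-- `(v_0, Δφ)_T - ⟨v_b, ∇φ·n⟩_{∂T} + ⟨v_n n_e·n, φ⟩_{∂T}` for the element `T` with index `a`. -/
def Mesh.weakLapRHS (v : M.V k) (a : ι) (φ : MvPolynomial (Fin d) ℝ) : ℝ :=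
  (∫ x in (M.elem a).carrier, pval (M.v0 v a) x * pval (lap φ) x)
    - (∑ i, ∫ x, M.vb v (M.face a i) x * dirDeriv φ ((M.elem a).normal i) x.1
        ∂(surfOn (M.face a i).1))
    + ∑ i, ∫ x, M.vnn ne v a i x * pval φ x.1 ∂(surfOn (M.face a i).1)

/-- `w ∈ P_j(T)` satisfies the equation that defines the weak Laplacian of `v` on `T`. -/
def Mesh.IsWeakLap (j : ℕ) (v : M.V k) (a : ι) (w : MvPolynomial (Fin d) ℝ) : Prop :=
  w ∈ Poly d j ∧ ∀ φ ∈ Poly d j,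
    ∫ x in (M.elem a).carrier, pval w x * pval φ x = M.weakLapRHS ne v a φ

/-- The weak Laplacian `Δ_w v` on the element `a`: the polynomial `w` with `IsWeakLap`. -/
def Mesh.weakLap (j : ℕ) (v : M.V k) (a : ι) : MvPolynomial (Fin d) ℝ :=
  Classical.epsilon (M.IsWeakLap ne j v a)

/-- `v ∈ V_h^0`: `v_b = 0` and `v_n n_e · n = 0` on each edge/face that lies on `∂Ω`. -/
def Mesh.IsV0 (v : M.V k) : Prop :=
  ∀ a i, (M.elem a).facet i ⊆ frontier Ω →
    (∀ x, M.vb v (M.face a i) x = 0) ∧ ∀ x, M.vnn ne v a i x = 0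

/-- `u = u_h` solves the weak Galerkin scheme for the data `f`, `g`, `φ`. -/
structure Mesh.IsWGSolution [Fintype ι] (j : ℕ) (f g φ : E d → ℝ) (u : M.V k) : Prop where
  /-- `u_b = Q_b g` on `∂Ω` -/
  dirichlet : ∀ a i, (M.elem a).facet i ⊆ frontier Ω →
    IsL2Projection k (M.face a i).1 g (M.vb u (M.face a i))
  /-- `u_n n_e · n = Q_n φ` on `∂Ω` -/
  neumann : ∀ a i, (M.elem a).facet i ⊆ frontier Ω →
    IsL2Projection (k - 1) (M.face a i).1 φ (M.vnn ne u a i)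
  /-- `(Δ_w u_h, Δ_w v) = (f, v_0)` for all `v ∈ V_h^0` -/
  equation : ∀ v : M.V k, M.IsV0 ne v →
    ∑ a, ∫ x in (M.elem a).carrier, pval (M.weakLap ne j u a) x * pval (M.weakLap ne j v a) x
      = ∑ a, ∫ x in (M.elem a).carrier, f x * pval (M.v0 v a) x

end Scheme

end WG

end

/-! Every existence claim reduces to definiteness of a bilinear form on a finite-dimensional space
(`existsUnique_of_definite`). For the weak Laplacian the form is the L² product on `P_j(T)`. For the
scheme, the boundary data are lifted to some `u₀`, and what remains is a problem on `V_h^0`, so the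
point is that `Δ_w v = 0` everywhere forces `v = 0` there (`eq_zero_of_form_self`).

Locally, Green's second identity turns the definition of `Δ_w v = 0` into the statement that the
residuals `Δv_0`, `v_0 - v_b` and `v_n n_e·n - ∇v_0·n` are jointly orthogonal to all test
polynomials and their normal derivatives. Testing against products of squared facet functions
isolates one residual at a time and makes each vanish; the degrees needed are at most `k + 2n_T -
1`. This is `ConvexPolytope.harmonic_of_weakLap_eq_zero`.

Globally, the energy of `v_0` becomes a sum of facet terms `v_b v_n n_e·n`. These are odd in the
normal, so neighbours cancel, and they vanish on `∂Ω` (`sum_facets_eq_zero`). Hence `v_0` is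
piecewise constant. The divergence theorem for the field `v_0² x_l` in direction `l` then gives `∑ ∫
v_0² = 0` by the same cancellation, and `v_b`, `v_n` vanish with `v_0`.

The divergence theorem on a convex polytope is proved by cutting it into cones over its facets with
a common interior apex (`setIntegral_radial`) and comparing two apices (`setIntegral_fderiv`). -/

noncomputable section

namespace WG

/-! ### Polynomials as functions: derivatives, degrees, identity principle. -/

section Polynomials

variable {d : ℕ}

@[simp] theorem pval_add (p q : MvPolynomial (Fin d) ℝ) (x : E d) :
    pval (p + q) x = pval p x + pval q x := by simp [pval]

@[simp] theorem pval_sub (p q : MvPolynomial (Fin d) ℝ) (x : E d) :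
    pval (p - q) x = pval p x - pval q x := by simp [pval]

@[simp] theorem pval_mul (p q : MvPolynomial (Fin d) ℝ) (x : E d) :
    pval (p * q) x = pval p x * pval q x := by simp [pval]

@[simp] theorem pval_pow (p : MvPolynomial (Fin d) ℝ) (n : ℕ) (x : E d) :
    pval (p ^ n) x = pval p x ^ n := by simp [pval]

@[simp] theorem pval_smul (c : ℝ) (p : MvPolynomial (Fin d) ℝ) (x : E d) :
    pval (c • p) x = c * pval p x := by simp [pval, MvPolynomial.smul_eval]

@[simp] theorem pval_C (c : ℝ) (x : E d) : pval (MvPolynomial.C c) x = c := by simp [pval]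

@[simp] theorem pval_X (i : Fin d) (x : E d) : pval (MvPolynomial.X i) x = x i := by simp [pval]

@[simp] theorem pval_zero (x : E d) : pval (0 : MvPolynomial (Fin d) ℝ) x = 0 := by simp [pval]

@[simp] theorem pval_one (x : E d) : pval (1 : MvPolynomial (Fin d) ℝ) x = 1 := by simp [pval]

theorem pval_sum {κ : Type*} (s : Finset κ) (p : κ → MvPolynomial (Fin d) ℝ) (x : E d) :
    pval (∑ a ∈ s, p a) x = ∑ a ∈ s, pval (p a) x := by simp [pval]

theorem pval_prod {κ : Type*} (s : Finset κ) (p : κ → MvPolynomial (Fin d) ℝ) (x : E d) :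
    pval (∏ a ∈ s, p a) x = ∏ a ∈ s, pval (p a) x := by simp [pval]

theorem dirDeriv_add (p q : MvPolynomial (Fin d) ℝ) (n x : E d) :
    dirDeriv (p + q) n x = dirDeriv p n x + dirDeriv q n x := by
  simp [dirDeriv, add_mul, Finset.sum_add_distrib]

theorem dirDeriv_smul (c : ℝ) (p : MvPolynomial (Fin d) ℝ) (n x : E d) :
    dirDeriv (c • p) n x = c * dirDeriv p n x := by
  simp [dirDeriv, Finset.mul_sum, mul_assoc]

theorem dirDeriv_mul (p q : MvPolynomial (Fin d) ℝ) (n x : E d) :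
    dirDeriv (p * q) n x = pval p x * dirDeriv q n x + dirDeriv p n x * pval q x := by
  simp only [dirDeriv, Derivation.leibniz, pval_add, smul_eq_mul, pval_mul, Finset.mul_sum,
    Finset.sum_mul, ← Finset.sum_add_distrib]
  exact Finset.sum_congr rfl fun i _ => by ring

/-- The polynomial `∇p · n`. -/
def dirDerivPoly (n : E d) (p : MvPolynomial (Fin d) ℝ) : MvPolynomial (Fin d) ℝ :=
  ∑ i, n i • MvPolynomial.pderiv i p

theorem pval_dirDerivPoly (n : E d) (p : MvPolynomial (Fin d) ℝ) (x : E d) :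
    pval (dirDerivPoly n p) x = dirDeriv p n x := by
  simp [dirDerivPoly, dirDeriv, pval_sum, mul_comm]

theorem continuous_pval (p : MvPolynomial (Fin d) ℝ) : Continuous (pval p) := by
  exact (MvPolynomial.continuous_eval p).comp (PiLp.continuous_ofLp 2 _)

theorem hasFDerivAt_pval (p : MvPolynomial (Fin d) ℝ) (x : E d) :
    HasFDerivAt (pval p)
      (∑ i, pval (MvPolynomial.pderiv i p) x • (EuclideanSpace.proj i : E d →L[ℝ] ℝ)) x := by
  induction p using MvPolynomial.induction_on with
  | C a =>
    have : pval (MvPolynomial.C a : MvPolynomial (Fin d) ℝ) = fun _ => a := by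
      funext y; simp
    rw [this]
    simpa using hasFDerivAt_const a x
  | add p q hp hq =>
    have : pval (p + q) = fun y => pval p y + pval q y := by funext y; simp
    rw [this]
    refine (hp.add hq).congr_fderiv ?_
    simp [add_smul, Finset.sum_add_distrib]
  | mul_X p i hp =>
    have : pval (p * MvPolynomial.X i) = fun y => pval p y *
        (EuclideanSpace.proj i : E d →L[ℝ] ℝ) y := by
      funext y; simp
    rw [this]
    refine (hp.mul (EuclideanSpace.proj i : E d →L[ℝ] ℝ).hasFDerivAt).congr_fderiv ?_
    simp only [Derivation.leibniz, smul_eq_mul, pval_add, pval_mul, add_smul,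
      Finset.sum_add_distrib, MvPolynomial.pderiv_X, pval_X, Finset.smul_sum]
    congr 1
    · rw [Finset.sum_eq_single i]
      · simp
      · intro j _ hj
        simp [hj.symm]
      · simp
    · exact Finset.sum_congr rfl fun j _ => by simp [smul_smul]

theorem fderiv_pval_apply (p : MvPolynomial (Fin d) ℝ) (x v : E d) :
    fderiv ℝ (pval p) x v = dirDeriv p v x := by
  rw [(hasFDerivAt_pval p x).fderiv]
  simp [dirDeriv]

theorem contDiff_pval (p : MvPolynomial (Fin d) ℝ) : ContDiff ℝ 1 (pval p) := by
  rw [contDiff_one_iff_fderiv]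
  refine ⟨fun x => (hasFDerivAt_pval p x).differentiableAt, ?_⟩
  have : fderiv ℝ (pval p) = fun x =>
      ∑ i, pval (MvPolynomial.pderiv i p) x • (EuclideanSpace.proj i : E d →L[ℝ] ℝ) :=
    funext fun x => (hasFDerivAt_pval p x).fderiv
  rw [this]
  exact continuous_finsetSum _ fun i _ => (continuous_pval _).smul continuous_const

/-- A polynomial that vanishes on a set with nonempty interior is zero. -/
theorem eq_zero_of_pval_eq_zero {p : MvPolynomial (Fin d) ℝ} {s : Set (E d)}
    (hs : (interior s).Nonempty) (h : ∀ x ∈ interior s, pval p x = 0) : p = 0 := by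
  obtain ⟨x₀, hx₀⟩ := hs
  -- In the sup norm a ball is a product of intervals, and a polynomial vanishing on a product of
  -- infinite sets is zero.
  have hopen : IsOpen ((WithLp.toLp 2 : (Fin d → ℝ) → E d) ⁻¹' interior s) :=
    isOpen_interior.preimage (PiLp.continuous_toLp 2 _)
  obtain ⟨ε, hε, hball⟩ := Metric.isOpen_iff.1 hopen (WithLp.ofLp x₀) (by simpa using hx₀)
  refine MvPolynomial.funext_set (fun i => Metric.ball (x₀ i) ε) (fun i => ?_) fun x hx => ?_
  · rw [Real.ball_eq_Ioo]
    exact Set.Ioo_infinite (by linarith)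
  · rw [← ball_pi _ hε] at hx
    simpa [pval] using h _ (hball hx)

theorem totalDegree_pderiv_le (i : Fin d) (p : MvPolynomial (Fin d) ℝ) :
    (MvPolynomial.pderiv i p).totalDegree ≤ p.totalDegree - 1 := by
  classical
  conv_lhs => rw [p.as_sum, map_sum]
  refine MvPolynomial.totalDegree_finsetSum_le fun m hm => ?_
  rw [MvPolynomial.pderiv_monomial]
  by_cases hmi : m i = 0
  · simp [hmi]
  · refine (MvPolynomial.totalDegree_monomial_le _ _).trans ?_
    have h1 : (m.sum fun _ e => e) ≤ p.totalDegree := MvPolynomial.le_totalDegree hm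
    have h2 : (m.sum fun _ e => e) = ((m - Finsupp.single i 1).sum fun _ e => e) + 1 := by
      have h3 : m = (m - Finsupp.single i 1) + Finsupp.single i 1 := by
        rw [tsub_add_cancel_of_le]
        rw [Finsupp.single_le_iff]
        omega
      conv_lhs => rw [h3]
      rw [Finsupp.sum_add_index' (by simp) (by simp)]
      simp
    change ((m - Finsupp.single i 1).sum fun _ e => e) ≤ _
    omega

theorem pderiv_mem_Poly {m : ℕ} (i : Fin d) {p : MvPolynomial (Fin d) ℝ} (hp : p ∈ Poly d m) :
    MvPolynomial.pderiv i p ∈ Poly d (m - 1) := by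
  rw [MvPolynomial.mem_restrictTotalDegree] at *
  exact (totalDegree_pderiv_le i p).trans (by omega)

/-- The degree really drops by two, but `m - 1` suffices: together with a bubble of degree `2n` it
gives `k + 2n - 1`. -/
theorem lap_mem_Poly {m : ℕ} {p : MvPolynomial (Fin d) ℝ} (hp : p ∈ Poly d m) :
    lap p ∈ Poly d (m - 1) := by
  refine Submodule.sum_mem _ fun i _ => ?_
  have := pderiv_mem_Poly i (pderiv_mem_Poly i hp)
  rw [MvPolynomial.mem_restrictTotalDegree] at *
  omega

theorem dirDerivPoly_mem_Poly {m : ℕ} {p : MvPolynomial (Fin d) ℝ} (n : E d)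
    (hp : p ∈ Poly d m) : dirDerivPoly n p ∈ Poly d (m - 1) :=
  Submodule.sum_mem _ fun i _ => Submodule.smul_mem _ _ (pderiv_mem_Poly i hp)

theorem Poly_mono {m m' : ℕ} (h : m ≤ m') : Poly d m ≤ Poly d m' := fun p hp => by
  rw [MvPolynomial.mem_restrictTotalDegree] at *
  omega

theorem mul_mem_Poly {m m' : ℕ} {p q : MvPolynomial (Fin d) ℝ} (hp : p ∈ Poly d m)
    (hq : q ∈ Poly d m') : p * q ∈ Poly d (m + m') := by
  rw [MvPolynomial.mem_restrictTotalDegree] at *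
  exact (MvPolynomial.totalDegree_mul _ _).trans (by omega)

theorem lap_add (p q : MvPolynomial (Fin d) ℝ) : lap (p + q) = lap p + lap q := by
  simp [lap, Finset.sum_add_distrib]

theorem lap_smul (c : ℝ) (p : MvPolynomial (Fin d) ℝ) : lap (c • p) = c • lap p := by
  simp [lap, Finset.smul_sum]

/-- The affine function `x ↦ ⟪n, x⟫ - b` as a polynomial. -/
def affinePoly (n : E d) (b : ℝ) : MvPolynomial (Fin d) ℝ :=
  (∑ i, n i • MvPolynomial.X i) - MvPolynomial.C b

theorem pval_affinePoly (n : E d) (b : ℝ) (x : E d) :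
    pval (affinePoly n b) x = inner ℝ n x - b := by
  simp [affinePoly, pval_sum, PiLp.inner_apply, mul_comm]

theorem affinePoly_mem_Poly (n : E d) (b : ℝ) : affinePoly n b ∈ Poly d 1 := by
  refine Submodule.sub_mem _ (Submodule.sum_mem _ fun i _ => Submodule.smul_mem _ _ ?_) ?_ <;>
    rw [MvPolynomial.mem_restrictTotalDegree] <;> simp

theorem dirDeriv_affinePoly (n m x : E d) (b : ℝ) :
    dirDeriv (affinePoly n b) m x = inner ℝ n m := by
  have : ∀ i, MvPolynomial.pderiv i (affinePoly n b) = MvPolynomial.C (n i) := by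
    intro i
    simp only [affinePoly, map_sub, map_sum, MvPolynomial.pderiv_C, sub_zero, Derivation.map_smul,
      MvPolynomial.pderiv_X]
    rw [Finset.sum_eq_single i]
    · simp [MvPolynomial.smul_eq_C_mul]
    · intro j _ hj
      simp [hj]
    · simp
  simp [dirDeriv, this, PiLp.inner_apply, mul_comm]

end Polynomials

/-! ### Facets of a convex polytope and their relative interiors. -/

section Geometry

variable {d : ℕ} (T : ConvexPolytope d)

namespace ConvexPolytope

theorem carrier_eq : T.carrier = {x : E d | ∀ i, inner ℝ (T.normal i) x ≤ T.offset i} := rfl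

theorem isClosed_carrier : IsClosed T.carrier := by
  rw [carrier_eq, Set.ofPred_forall]
  exact isClosed_iInter fun i => isClosed_le (by fun_prop) continuous_const

theorem isCompact_carrier : IsCompact T.carrier :=
  Metric.isCompact_of_isClosed_isBounded T.isClosed_carrier T.bounded

theorem convex_carrier : Convex ℝ T.carrier := by
  rw [carrier_eq, Set.ofPred_forall]
  exact convex_iInter fun i => convex_halfSpace_le
    (innerₛₗ ℝ (T.normal i)).isLinear _

theorem facet_subset (i : Fin T.n) : T.facet i ⊆ T.carrier := fun _ hx => hx.1

theorem isClosed_facet (i : Fin T.n) : IsClosed (T.facet i) :=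
  T.isClosed_carrier.inter (isClosed_eq (by fun_prop) continuous_const)

theorem isCompact_facet (i : Fin T.n) : IsCompact (T.facet i) :=
  T.isCompact_carrier.of_isClosed_subset (T.isClosed_facet i) (T.facet_subset i)

theorem mem_interior_of_lt {x : E d} (hx : ∀ i, inner ℝ (T.normal i) x < T.offset i) :
    x ∈ interior T.carrier := by
  refine mem_interior.2 ⟨{x | ∀ i, inner ℝ (T.normal i) x < T.offset i},
    fun y hy i => (hy i).le, ?_, hx⟩
  rw [Set.ofPred_forall]
  exact isOpen_iInter_of_finite fun i => isOpen_lt (by fun_prop) continuous_const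

/-- A small step along the unit normal stays in the polytope and raises the constraint by the length
of the step. -/
theorem lt_of_mem_interior {x : E d} (hx : x ∈ interior T.carrier) (i : Fin T.n) :
    inner ℝ (T.normal i) x < T.offset i := by
  have hc : Continuous fun t : ℝ => x + t • T.normal i := by fun_prop
  have hopen : IsOpen ((fun t : ℝ => x + t • T.normal i) ⁻¹' interior T.carrier) :=
    isOpen_interior.preimage hc
  obtain ⟨ε, hε, hball⟩ := Metric.isOpen_iff.1 hopen 0 (by simpa using hx)
  have h1 : ε / 2 ∈ Metric.ball (0 : ℝ) ε := by
    simp only [Metric.mem_ball, dist_zero_right, Real.norm_eq_abs]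
    rw [abs_of_pos (by linarith)]
    linarith
  have h2 := interior_subset (hball h1) i
  simp only [inner_add_right, inner_smul_right, real_inner_self_eq_norm_sq, T.norm_normal] at h2
  linarith

/-- The relative interior of the `i`-th facet. -/
def relint (i : Fin T.n) : Set (E d) :=
  {x | inner ℝ (T.normal i) x = T.offset i ∧ ∀ j, j ≠ i → inner ℝ (T.normal j) x < T.offset j}

theorem relint_nonempty (i : Fin T.n) : (T.relint i).Nonempty := T.irredundant i

theorem relint_subset (i : Fin T.n) : T.relint i ⊆ T.facet i := fun x hx => by
  refine ⟨fun j => ?_, hx.1⟩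
  by_cases h : j = i
  · exact h ▸ hx.1.le
  · exact (hx.2 j h).le

/-- Near a relative interior point of a facet, only the constraint of this facet matters. -/
theorem eventually_lt_of_mem_relint {i : Fin T.n} {x : E d} (hx : x ∈ T.relint i) :
    ∀ᶠ y in nhds x, ∀ j, j ≠ i → inner ℝ (T.normal j) y < T.offset j := by
  rw [Filter.eventually_all]
  intro j
  by_cases h : j = i
  · simp [h]
  · have : ∀ᶠ y in nhds x, inner ℝ (T.normal j) y < T.offset j :=
      (isOpen_lt (f := fun y => inner ℝ (T.normal j) y) (by fun_prop)
        continuous_const).eventually_mem (hx.2 j h)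
    exact this.mono fun y hy _ => hy

theorem lineMap_mem_relint {i : Fin T.n} {x y : E d} (hx : x ∈ T.relint i) (hy : y ∈ T.facet i)
    {t : ℝ} (ht : 0 < t) (ht1 : t ≤ 1) : (1 - t) • y + t • x ∈ T.relint i := by
  constructor
  · rw [inner_add_right, inner_smul_right, inner_smul_right, hx.1, hy.2]
    ring
  · intro j hj
    rw [inner_add_right, inner_smul_right, inner_smul_right]
    have h1 := hx.2 j hj
    have h2 := hy.1 j
    nlinarith

/-- The segment from any point of the facet to a relative interior point is relatively interior
except perhaps at its start. Identities between continuous functions therefore pass from the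
relative interior to the facet. -/
theorem facet_subset_closure_relint (i : Fin T.n) : T.facet i ⊆ closure (T.relint i) := by
  intro y hy
  obtain ⟨x, hx⟩ := T.relint_nonempty i
  have hc : Continuous fun t : ℝ => (1 - t) • y + t • x := by fun_prop
  have h0 : Filter.Tendsto (fun t : ℝ => (1 - t) • y + t • x) (nhdsWithin 0 (Set.Ioi 0))
      (nhds y) := by
    have := hc.tendsto 0
    simp only [sub_zero, one_smul, zero_smul, add_zero] at this
    exact this.mono_left nhdsWithin_le_nhds
  refine mem_closure_of_tendsto h0 ?_
  filter_upwards [Ioo_mem_nhdsGT (zero_lt_one' ℝ)] with t ht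
  exact T.lineMap_mem_relint hx hy ht.1 ht.2.le

theorem facet_injective : Function.Injective T.facet := by
  intro i i' h
  obtain ⟨x, hx⟩ := T.relint_nonempty i
  by_contra hne
  have h1 := hx.2 i' (Ne.symm hne)
  have h2 : x ∈ T.facet i' := h ▸ T.relint_subset i hx
  exact h1.ne h2.2

/-- A unit vector normal to a facet is the outward normal up to sign. -/
theorem eq_or_eq_neg_normal (i : Fin T.n) {m : E d} (hm : ‖m‖ = 1)
    (h : ∀ x ∈ T.facet i, ∀ y ∈ T.facet i, inner ℝ m (x - y) = 0) :
    m = T.normal i ∨ m = -T.normal i := by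
  obtain ⟨x, hx⟩ := T.relint_nonempty i
  -- Every `v` orthogonal to the normal is a direction along the facet at a relative interior point,
  -- hence orthogonal to `m`.
  have hmem : m ∈ (ℝ ∙ T.normal i)ᗮᗮ := by
    rw [Submodule.mem_orthogonal]
    intro v hv
    rw [Submodule.mem_orthogonal_singleton_iff_inner_right] at hv
    have hc : Filter.Tendsto (fun t : ℝ => x + t • v) (nhdsWithin 0 (Set.Ioi 0)) (nhds x) := by
      have hc : Continuous fun t : ℝ => x + t • v := by fun_prop
      have := hc.tendsto 0
      simp only [zero_smul, add_zero] at this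
      exact this.mono_left nhdsWithin_le_nhds
    obtain ⟨t, ht, ht0⟩ := ((hc.eventually (T.eventually_lt_of_mem_relint hx)).and
      self_mem_nhdsWithin).exists
    have hy : x + t • v ∈ T.facet i := by
      refine T.relint_subset i ⟨?_, ht⟩
      rw [inner_add_right, inner_smul_right, hv, hx.1]
      simp
    have := h _ hy _ (T.relint_subset i hx)
    rw [add_sub_cancel_left, inner_smul_right, mul_eq_zero] at this
    rw [real_inner_comm]
    exact this.resolve_left (ne_of_gt ht0)
  rw [Submodule.orthogonal_orthogonal, Submodule.mem_span_singleton] at hmem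
  obtain ⟨c, rfl⟩ := hmem
  rw [norm_smul, T.norm_normal, mul_one, Real.norm_eq_abs] at hm
  rcases eq_or_eq_neg_of_abs_eq hm with h | h <;> simp [h]

theorem facet_normal_inner_sub (i : Fin T.n) :
    ∀ x ∈ T.facet i, ∀ y ∈ T.facet i, inner ℝ (T.normal i) (x - y) = 0 := fun x hx y hy => by
  rw [inner_sub_right, hx.2, hy.2, sub_self]

end ConvexPolytope

end Geometry

/-! ### Integration over cones by slices. -/

section ConeIntegration

variable {K : Type*} [NormedAddCommGroup K] [InnerProductSpace ℝ K] [FiniteDimensional ℝ K]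
  [MeasurableSpace K] [BorelSpace K]

/-- The cone over `{h} × Q` with apex `0` in `ℝ × K`. -/
def coneOver (h : ℝ) (Q : Set K) : Set (ℝ × K) :=
  {p | (0 < p.1 ∧ p.1 ≤ h) ∧ (h / p.1) • p.2 ∈ Q}

theorem measurableSet_coneOver (h : ℝ) {Q : Set K} (hQ : MeasurableSet Q) :
    MeasurableSet (coneOver h Q) := by
  have h1 : Measurable fun p : ℝ × K => (h / p.1) • p.2 := by fun_prop
  exact ((measurableSet_lt measurable_const measurable_fst).inter
    (measurableSet_le measurable_fst measurable_const)).inter (h1 hQ)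

theorem integrableOn_coneOver {h : ℝ} (hh : 0 < h) {Q : Set K} (hQ : IsCompact Q)
    {g : ℝ × K → ℝ} (hg : Continuous g) :
    IntegrableOn g (coneOver h Q) := by
  obtain ⟨R, hR⟩ := hQ.isBounded.subset_closedBall 0
  have hsub : coneOver h Q ⊆ Set.Icc 0 h ×ˢ Metric.closedBall 0 R := by
    rintro ⟨s, z⟩ ⟨⟨h0, h1⟩, h2⟩
    refine ⟨⟨h0.le, h1⟩, ?_⟩
    have h3 := hR h2
    simp only [Metric.mem_closedBall, dist_zero_right, norm_smul, Real.norm_eq_abs] at h3 ⊢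
    rw [abs_of_pos (by positivity)] at h3
    have h4 : 1 ≤ h / s := (one_le_div h0).2 h1
    nlinarith [norm_nonneg z]
  exact (hg.continuousOn.integrableOn_compact
    (isCompact_Icc.prod (isCompact_closedBall 0 R))).mono_set hsub

/-- The slice at height `s` is `(s / h) • Q`, so Fubini and rescaling each slice to `Q` produce the
Jacobian `(s / h) ^ dim K`. -/
theorem setIntegral_coneOver {h : ℝ} (hh : 0 < h) {Q : Set K} (hQ : IsCompact Q)
    {g : ℝ × K → ℝ} (hg : Continuous g) :
    ∫ p in coneOver h Q, g p =
      ∫ z in Q, ∫ s in 0..h, (s / h) ^ Module.finrank ℝ K * g (s, (s / h) • z) := by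
  have hS := measurableSet_coneOver h hQ.measurableSet
  rw [← integral_indicator hS, Measure.volume_eq_prod, integral_prod _
    ((integrable_indicator_iff hS).2 (integrableOn_coneOver hh hQ hg))]
  have h1 : ∀ s : ℝ, ∫ z : K, (coneOver h Q).indicator g (s, z) =
      (Set.Ioc 0 h).indicator (fun s => ∫ z in Q,
        (s / h) ^ Module.finrank ℝ K * g (s, (s / h) • z)) s := by
    intro s
    by_cases hs : s ∈ Set.Ioc 0 h
    · have hs0 := hs.1
      rw [Set.indicator_of_mem hs]
      have h2 : ∀ z : K, (coneOver h Q).indicator g (s, z) =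
          (Q.indicator fun z => g (s, (s / h) • z)) ((h / s) • z) := by
        intro z
        by_cases hz : (h / s) • z ∈ Q
        · rw [Set.indicator_of_mem hz, Set.indicator_of_mem (show (s, z) ∈ coneOver h Q from
            ⟨hs, hz⟩), smul_smul]
          have : s / h * (h / s) = 1 := by field_simp
          rw [this, one_smul]
        · rw [Set.indicator_of_notMem hz, Set.indicator_of_notMem fun hc => hz hc.2]
      simp_rw [h2]
      rw [Measure.integral_comp_smul volume (Q.indicator fun z => g (s, (s / h) • z)),
        integral_indicator hQ.measurableSet, integral_const_mul, smul_eq_mul]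
      congr 1
      rw [abs_of_pos (by positivity), ← inv_pow, inv_div]
    · rw [Set.indicator_of_notMem hs]
      have h2 : ∀ z : K, (coneOver h Q).indicator g (s, z) = 0 := fun z =>
        Set.indicator_of_notMem (fun hc => hs hc.1) _
      simp [h2]
  simp_rw [h1]
  rw [integral_indicator measurableSet_Ioc, integral_integral_swap]
  · simp_rw [intervalIntegral.integral_of_le hh.le]
  · rw [Measure.prod_restrict]
    have hc : Continuous fun p : ℝ × K =>
        (p.1 / h) ^ Module.finrank ℝ K * g (p.1, (p.1 / h) • p.2) := by fun_prop
    exact (hc.continuousOn.integrableOn_compact (isCompact_Icc.prod hQ)).mono_set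
      (Set.prod_mono_left Set.Ioc_subset_Icc_self)

variable {F : Type*} [NormedAddCommGroup F] [NormedSpace ℝ F]

/-- The integrand is the derivative of `s ↦ h (s / h) ^ (m + 1) f (x + (s / h) • w)`; here `m + 1`
plays the dimension of the cone. -/
theorem intervalIntegral_radial {f : F → ℝ} (hf : ContDiff ℝ 1 f) (m : ℕ) {h : ℝ} (hh : 0 < h)
    (x w : F) :
    ∫ s in 0..h, (s / h) ^ m * ((m + 1 : ℝ) * f (x + (s / h) • w) +
      fderiv ℝ f (x + (s / h) • w) ((s / h) • w)) = h * f (x + w) := by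
  have hd : ∀ s ∈ Set.uIcc 0 h, HasDerivAt (fun s => h * ((s / h) ^ (m + 1) * f (x + (s / h) • w)))
      ((s / h) ^ m * ((m + 1 : ℝ) * f (x + (s / h) • w) +
      fderiv ℝ f (x + (s / h) • w) ((s / h) • w))) s := by
    intro s _
    have h1 : HasDerivAt (fun s : ℝ => s / h) (1 / h) s := (hasDerivAt_id s).div_const h
    have h2 : HasDerivAt (fun s : ℝ => x + (s / h) • w) ((1 / h) • w) s :=
      (h1.smul_const w).const_add x
    have h3 := ((hf.differentiable (by simp)) (x + (s / h) • w)).hasFDerivAt.comp_hasDerivAt s h2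
    refine (((h1.pow (m + 1)).mul h3).const_mul h).congr_deriv ?_
    simp only [map_smul, smul_eq_mul, Nat.cast_add, Nat.cast_one, Nat.add_sub_cancel,
      Function.comp, Pi.pow_apply]
    have h4 : h * (1 / h) = 1 := by field_simp
    linear_combination ((s / h) ^ m * ((m + 1 : ℝ) * f (x + (s / h) • w) +
      s / h * fderiv ℝ f (x + (s / h) • w) w)) * h4
  have hfd : Continuous (fderiv ℝ f) := hf.continuous_fderiv (by simp)
  have hfc : Continuous f := hf.continuous
  rw [intervalIntegral.integral_eq_sub_of_hasDerivAt hd]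
  · simp [hh.ne']
  · apply Continuous.intervalIntegrable
    fun_prop

/-- The divergence of the field `f(y) (y - x)` integrates over a cone with apex `x` to its flux
through the base. -/
theorem setIntegral_coneOver_radial {f : F → ℝ} (hf : ContDiff ℝ 1 f) {h : ℝ} (hh : 0 < h)
    {Q : Set K} (hQ : IsCompact Q) (x n : F) (ι : K →L[ℝ] F) :
    ∫ p in coneOver h Q, ((Module.finrank ℝ K + 1 : ℝ) * f (x + (p.1 • n + ι p.2)) +
      fderiv ℝ f (x + (p.1 • n + ι p.2)) (p.1 • n + ι p.2)) =
      h * ∫ z in Q, f (x + (h • n + ι z)) := by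
  have hfd : Continuous (fderiv ℝ f) := hf.continuous_fderiv (by simp)
  have hfc : Continuous f := hf.continuous
  rw [setIntegral_coneOver hh hQ (by fun_prop), ← integral_const_mul]
  congr 1
  funext z
  rw [← intervalIntegral_radial hf (Module.finrank ℝ K) hh]
  congr 1
  funext s
  have : s • n + ι ((s / h) • z) = (s / h) • (h • n + ι z) := by
    rw [map_smul, smul_add, smul_smul]
    field_simp
  simp only [this]

end ConeIntegration

/-! ### Surface measure on hyperplanes as Lebesgue measure. -/

section Hyperplane

variable {d : ℕ}

theorem finrank_orthogonal_span {n : E d} (hn : ‖n‖ = 1) :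
    Module.finrank ℝ (ℝ ∙ n)ᗮ = d - 1 := by
  have h0 : n ≠ 0 := by rintro rfl; simp at hn
  have h1 := (ℝ ∙ n).finrank_add_finrank_orthogonal
  rw [finrank_span_singleton h0, finrank_euclideanSpace_fin] at h1
  omega

/-- The coordinates `(s, z) ↦ x + s n + z` with `z ⟂ n`. -/
def normalCoord {n : E d} (hn : ‖n‖ = 1) (x : E d) : ℝ × (ℝ ∙ n)ᗮ ≃ᵐ E d :=
  (MeasurableEquiv.prodCongr
    (LinearIsometryEquiv.toSpanUnitSingleton (𝕜 := ℝ) n hn).toHomeomorph.toMeasurableEquiv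
    (MeasurableEquiv.refl _)).trans ((ℝ ∙ n).measurableEquivProd x).symm

theorem normalCoord_apply {n : E d} (hn : ‖n‖ = 1) (x : E d) (p : ℝ × (ℝ ∙ n)ᗮ) :
    normalCoord hn x p = x + (p.1 • n + (p.2 : E d)) := by
  simp [normalCoord, MeasurableEquiv.prodCongr, add_comm]

theorem measurePreserving_normalCoord {n : E d} (hn : ‖n‖ = 1) (x : E d) :
    MeasurePreserving (normalCoord hn x) volume volume := by
  have h1 := ((ℝ ∙ n).measurePreserving_measurableEquivProd x).symm
  have h2 : (μHE[Module.finrank ℝ (E d)] : Measure (E d)) = volume :=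
    InnerProductSpace.euclideanHausdorffMeasure_eq_volume
  rw [h2] at h1
  have h3 := (LinearIsometryEquiv.toSpanUnitSingleton (𝕜 := ℝ) n hn).measurePreserving
  exact h1.comp (h3.prod (MeasurePreserving.id _))

/-- Surface integrals over subsets of a hyperplane are Lebesgue integrals. -/
theorem setIntegral_surf_hyperplane {n : E d} (hn : ‖n‖ = 1) (x : E d) {e : Set (E d)}
    (he : ∀ y ∈ e, inner ℝ n (y - x) = 0) (hm : MeasurableSet e) (f : E d → ℝ) :
    ∫ y in e, f y ∂(surf d) = ∫ z in (fun z : (ℝ ∙ n)ᗮ => x + (z : E d)) ⁻¹' e, f (x + z) := by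
  have hiso : Isometry fun z : (ℝ ∙ n)ᗮ => x + (z : E d) :=
    (isometry_add_left x).comp isometry_subtype_coe
  have hemb : MeasurableEmbedding fun z : (ℝ ∙ n)ᗮ => x + (z : E d) :=
    hiso.isClosedEmbedding.measurableEmbedding
  -- Normalised Hausdorff measure is volume on a Euclidean space of the same dimension, and
  -- isometries preserve it.
  have hvol : (volume : Measure (ℝ ∙ n)ᗮ) = μHE[d - 1] := by
    rw [← finrank_orthogonal_span hn, InnerProductSpace.euclideanHausdorffMeasure_eq_volume]
  have hsub : e ⊆ Set.range fun z : (ℝ ∙ n)ᗮ => x + (z : E d) := fun y hy =>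
    ⟨⟨y - x, Submodule.mem_orthogonal_singleton_iff_inner_right.2 (he y hy)⟩, by simp⟩
  rw [hvol, ← hemb.setIntegral_map, hiso.map_euclideanHausdorffMeasure,
    Measure.restrict_restrict hm, Set.inter_eq_left.2 hsub, surf]

theorem surf_hyperplane {n : E d} (hn : ‖n‖ = 1) (x : E d) {e : Set (E d)}
    (he : ∀ y ∈ e, inner ℝ n (y - x) = 0) :
    surf d e = volume ((fun z : (ℝ ∙ n)ᗮ => x + (z : E d)) ⁻¹' e) := by
  have hiso : Isometry fun z : (ℝ ∙ n)ᗮ => x + (z : E d) :=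
    (isometry_add_left x).comp isometry_subtype_coe
  have hvol : (volume : Measure (ℝ ∙ n)ᗮ) = μHE[d - 1] := by
    rw [← finrank_orthogonal_span hn, InnerProductSpace.euclideanHausdorffMeasure_eq_volume]
  have hsub : e ⊆ Set.range fun z : (ℝ ∙ n)ᗮ => x + (z : E d) := fun y hy =>
    ⟨⟨y - x, Submodule.mem_orthogonal_singleton_iff_inner_right.2 (he y hy)⟩, by simp⟩
  rw [hvol, hiso.euclideanHausdorffMeasure_preimage, Set.inter_eq_left.2 hsub, surf]

end Hyperplane

/-! ### The divergence theorem on a convex polytope. -/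

section Divergence

variable {d : ℕ} (T : ConvexPolytope d)

namespace ConvexPolytope

/-- The distance of `x` to the hyperplane of the `i`-th facet. -/
def height (x : E d) (i : Fin T.n) : ℝ := T.offset i - inner ℝ (T.normal i) x

/-- The part of the polytope in the cone with apex `x` over the `i`-th facet. -/
def cone (x : E d) (i : Fin T.n) : Set (E d) :=
  {y | (0 < inner ℝ (T.normal i) (y - x) ∧ inner ℝ (T.normal i) (y - x) ≤ T.height x i) ∧
    ∀ j, inner ℝ (T.normal j) (y - x) / T.height x j ≤
      inner ℝ (T.normal i) (y - x) / T.height x i}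

variable {T}

theorem height_pos {x : E d} (hx : x ∈ interior T.carrier) (i : Fin T.n) : 0 < T.height x i :=
  sub_pos.2 (T.lt_of_mem_interior hx i)

theorem mem_carrier_iff {x y : E d} :
    y ∈ T.carrier ↔ ∀ i, inner ℝ (T.normal i) (y - x) ≤ T.height x i := by
  simp [carrier, height, inner_sub_right]

theorem measurableSet_cone (x : E d) (i : Fin T.n) : MeasurableSet (T.cone x i) := by
  have hm : ∀ j, Measurable fun y : E d => (inner ℝ (T.normal j) (y - x) : ℝ) := fun j =>
    Continuous.measurable (by fun_prop)
  refine ((measurableSet_lt measurable_const (hm i)).inter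
    (measurableSet_le (hm i) measurable_const)).inter ?_
  change MeasurableSet {y : E d | ∀ j, inner ℝ (T.normal j) (y - x) / T.height x j ≤
      inner ℝ (T.normal i) (y - x) / T.height x i}
  rw [Set.ofPred_forall]
  exact MeasurableSet.iInter fun j =>
    measurableSet_le ((hm j).div_const _) ((hm i).div_const _)

theorem cone_subset {x : E d} (hx : x ∈ interior T.carrier) (i : Fin T.n) :
    T.cone x i ⊆ T.carrier := fun y hy => by
  refine (mem_carrier_iff (x := x)).2 fun j => ?_
  have h1 := hy.2 j
  have h2 : inner ℝ (T.normal i) (y - x) / T.height x i ≤ 1 :=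
    (div_le_one (height_pos hx i)).2 hy.1.2
  exact (div_le_one (height_pos hx j)).1 (h1.trans h2)

/-- Otherwise a whole ray in direction `v` would lie in the bounded polytope. -/
theorem exists_inner_pos {v : E d} (hv : v ≠ 0) : ∃ i, 0 < inner ℝ (T.normal i) v := by
  by_contra! h
  obtain ⟨x, hx⟩ := T.nonempty_interior
  have hx := interior_subset hx
  obtain ⟨R, hR⟩ := T.bounded.subset_closedBall x
  have hv' : 0 < ‖v‖ := norm_pos_iff.2 hv
  have hR0 : 0 ≤ R := by simpa using Metric.mem_closedBall.1 (hR hx)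
  have hmem : x + ((R + 1) / ‖v‖) • v ∈ Metric.closedBall x R := by
    refine hR fun i => ?_
    rw [inner_add_right, inner_smul_right]
    have h1 : (R + 1) / ‖v‖ * inner ℝ (T.normal i) v ≤ 0 :=
      mul_nonpos_of_nonneg_of_nonpos (by positivity) (h i)
    have h2 := hx i
    linarith
  rw [Metric.mem_closedBall, dist_eq_norm, add_sub_cancel_left, norm_smul, norm_div, norm_norm,
    div_mul_cancel₀ _ hv'.ne', Real.norm_eq_abs, abs_of_nonneg (by linarith)] at hmem
  linarith

/-- The ray from `x` through `y` leaves through a facet that maximises `⟪ν_j, y - x⟫ / height j`,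
and this maximum is positive. The apex is excluded because cones demand positive height. -/
theorem carrier_subset_iUnion_cone {x : E d} (hx : x ∈ interior T.carrier) :
    T.carrier \ {x} ⊆ ⋃ i, T.cone x i := by
  rintro y ⟨hy, hne⟩
  have hne : y - x ≠ 0 := sub_ne_zero.2 hne
  obtain ⟨i₀, hi₀⟩ := exists_inner_pos (T := T) hne
  obtain ⟨i, -, hi⟩ := Finset.exists_max_image Finset.univ
    (fun j => inner ℝ (T.normal j) (y - x) / T.height x j) ⟨i₀, Finset.mem_univ _⟩
  refine Set.mem_iUnion.2 ⟨i, ⟨?_, (mem_carrier_iff (x := x)).1 hy i⟩, fun j => hi j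
    (Finset.mem_univ _)⟩
  have h1 := hi i₀ (Finset.mem_univ _)
  have h2 : 0 < inner ℝ (T.normal i₀) (y - x) / T.height x i₀ := div_pos hi₀ (height_pos hx i₀)
  exact (div_pos_iff_of_pos_right (height_pos hx i)).1 (h2.trans_le h1)

/-- Two cones meet only where their ratios agree, an affine subspace through `x`. It is proper: at a
relative interior point of facet `i` one ratio is `1` and the other is smaller. -/
theorem aedisjoint_cone {x : E d} (hx : x ∈ interior T.carrier) :
    Pairwise (Function.onFun (AEDisjoint volume) (T.cone x)) := by
  intro i j hij
  have hi := height_pos hx i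
  have hj := height_pos hx j
  set v : E d := (T.height x i)⁻¹ • T.normal i - (T.height x j)⁻¹ • T.normal j with hv
  have hinner : ∀ y, inner ℝ v (y - x) = inner ℝ (T.normal i) (y - x) / T.height x i -
      inner ℝ (T.normal j) (y - x) / T.height x j := fun y => by
    rw [hv, inner_sub_left, real_inner_smul_left, real_inner_smul_left]
    ring
  let P : AffineSubspace ℝ (E d) := AffineSubspace.mk' x (ℝ ∙ v)ᗮ
  refine measure_mono_null (t := (P : Set (E d))) ?_ (Measure.addHaar_affineSubspace _ _ ?_)
  · rintro y ⟨hyi, hyj⟩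
    change y ∈ P
    rw [AffineSubspace.mem_mk', vsub_eq_sub, Submodule.mem_orthogonal_singleton_iff_inner_right,
      hinner, sub_eq_zero]
    exact le_antisymm (hyj.2 i) (hyi.2 j)
  · intro htop
    obtain ⟨y, hy⟩ := T.relint_nonempty i
    have hyP : y ∈ P := htop ▸ AffineSubspace.mem_top ℝ (E d) y
    rw [AffineSubspace.mem_mk', vsub_eq_sub, Submodule.mem_orthogonal_singleton_iff_inner_right,
      hinner] at hyP
    have h1 : inner ℝ (T.normal i) (y - x) / T.height x i = 1 := by
      rw [div_eq_one_iff_eq hi.ne', inner_sub_right, hy.1, height]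
    have h2 : inner ℝ (T.normal j) (y - x) / T.height x j < 1 := by
      rw [div_lt_one hj, inner_sub_right, height]
      have := hy.2 j hij.symm
      linarith
    linarith

/-- Scaling `y - x` by `height / s` moves `y` onto the hyperplane of the facet, and the ratio
inequalities say exactly that the image satisfies every constraint of `T`. -/
theorem normalCoord_preimage_cone {x : E d} (hx : x ∈ interior T.carrier) (i : Fin T.n) :
    normalCoord (T.norm_normal i) x ⁻¹' T.cone x i = coneOver (T.height x i)
      ((fun z : (ℝ ∙ T.normal i)ᗮ => (x + T.height x i • T.normal i) + (z : E d)) ⁻¹'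
        T.facet i) := by
  ext ⟨s, z⟩
  have hi := height_pos hx i
  have hz : inner ℝ (T.normal i) (z : E d) = 0 :=
    Submodule.mem_orthogonal_singleton_iff_inner_right.1 z.2
  have hn : inner ℝ (T.normal i) (T.normal i) = 1 := by
    rw [real_inner_self_eq_norm_sq, T.norm_normal, one_pow]
  have hs : inner ℝ (T.normal i) (s • T.normal i + (z : E d)) = s := by
    rw [inner_add_right, inner_smul_right, hn, hz]
    ring
  rw [Set.mem_preimage, normalCoord_apply]
  simp only [cone, coneOver, Set.mem_ofPred_eq, add_sub_cancel_left, hs]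
  refine and_congr_right fun ⟨hs0, _⟩ => ?_
  have key : x + T.height x i • T.normal i + ((T.height x i / s) • z : (ℝ ∙ T.normal i)ᗮ) =
      x + (T.height x i / s) • (s • T.normal i + (z : E d)) := by
    rw [Submodule.coe_smul, smul_add, smul_smul, div_mul_cancel₀ _ hs0.ne', add_assoc]
  rw [Set.mem_preimage, key]
  have h2 : inner ℝ (T.normal i) (x + (T.height x i / s) • (s • T.normal i + (z : E d))) =
      T.offset i := by
    rw [inner_add_right, inner_smul_right, hs, div_mul_cancel₀ _ hs0.ne', height]
    ring
  simp only [facet, Set.mem_ofPred_eq, h2, and_true, mem_carrier_iff (x := x),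
    add_sub_cancel_left]
  refine forall_congr' fun j => ?_
  rw [inner_smul_right, div_le_iff₀ (height_pos hx j), div_mul_eq_mul_div,
    div_mul_eq_mul_div, div_le_iff₀ hs0, le_div_iff₀ hi]
  rw [mul_comm (T.height x i), mul_comm s]

theorem facet_inner_sub {x : E d} (i : Fin T.n) :
    ∀ y ∈ T.facet i, inner ℝ (T.normal i) (y - (x + T.height x i • T.normal i)) = 0 := by
  intro y hy
  rw [inner_sub_right, inner_add_right, inner_smul_right, real_inner_self_eq_norm_sq,
    T.norm_normal, hy.2, height]
  ring

/-- The integrand is the divergence of `f(y) (y - x)`. This field is tangent to the lateral sides of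
the cone, and on the base its normal component is `f` times the constant height. -/
theorem setIntegral_cone_radial (hd : 0 < d) {f : E d → ℝ} (hf : ContDiff ℝ 1 f) {x : E d}
    (hx : x ∈ interior T.carrier) (i : Fin T.n) :
    ∫ y in T.cone x i, ((d : ℝ) * f y + fderiv ℝ f y (y - x)) =
      T.height x i * ∫ y in T.facet i, f y ∂(surf d) := by
  have hi := height_pos hx i
  rw [← (measurePreserving_normalCoord (T.norm_normal i) x).setIntegral_preimage_emb
    (normalCoord (T.norm_normal i) x).measurableEmbedding, normalCoord_preimage_cone hx,
    setIntegral_surf_hyperplane (T.norm_normal i) (x + T.height x i • T.normal i)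
      (facet_inner_sub i) (T.isClosed_facet i).measurableSet]
  have hiso : Isometry fun z : (ℝ ∙ T.normal i)ᗮ =>
      (x + T.height x i • T.normal i) + (z : E d) :=
    (isometry_add_left _).comp isometry_subtype_coe
  have hQ := hiso.isClosedEmbedding.isCompact_preimage (T.isCompact_facet i)
  have h := setIntegral_coneOver_radial hf hi hQ x (T.normal i) (ℝ ∙ T.normal i)ᗮ.subtypeL
  simp only [Submodule.subtypeL_apply] at h
  have hdim : ((Module.finrank ℝ (ℝ ∙ T.normal i)ᗮ : ℕ) + 1 : ℝ) = d := by
    rw [finrank_orthogonal_span (T.norm_normal i)]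
    exact_mod_cast Nat.sub_add_cancel hd
  rw [hdim] at h
  simp only [normalCoord_apply, add_sub_cancel_left, add_assoc] at h ⊢
  exact h

theorem setIntegral_radial (hd : 0 < d) {f : E d → ℝ} (hf : ContDiff ℝ 1 f) {x : E d}
    (hx : x ∈ interior T.carrier) :
    ∫ y in T.carrier, ((d : ℝ) * f y + fderiv ℝ f y (y - x)) =
      ∑ i, T.height x i * ∫ y in T.facet i, f y ∂(surf d) := by
  -- Positive dimension makes the apex a null set.
  have : Nonempty (Fin d) := ⟨⟨0, hd⟩⟩
  have hfd : Continuous (fderiv ℝ f) := hf.continuous_fderiv (by simp)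
  have hfc : Continuous f := hf.continuous
  have hae : T.carrier =ᵐ[volume] ⋃ i, T.cone x i := by
    refine Filter.EventuallyLE.antisymm ?_
      (Set.iUnion_subset fun i => cone_subset hx i).eventuallyLE
    rw [ae_le_set]
    refine measure_mono_null (t := {x}) (fun y hy => ?_) (measure_singleton x)
    by_contra hne
    exact hy.2 (carrier_subset_iUnion_cone hx ⟨hy.1, hne⟩)
  have hint : IntegrableOn (fun y => (d : ℝ) * f y + fderiv ℝ f y (y - x)) T.carrier :=
    Continuous.continuousOn (by fun_prop) |>.integrableOn_compact T.isCompact_carrier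
  rw [setIntegral_congr_set hae, integral_iUnion_ae
    (fun i => (measurableSet_cone x i).nullMeasurableSet) (aedisjoint_cone hx)
    (hint.mono_set (Set.iUnion_subset fun i => cone_subset hx i)), tsum_fintype]
  exact Finset.sum_congr rfl fun i _ => setIntegral_cone_radial hd hf hx i

/-- The divergence theorem on a convex polytope, for fields of constant direction. -/
theorem setIntegral_fderiv (hd : 0 < d) {f : E d → ℝ} (hf : ContDiff ℝ 1 f) (c : E d) :
    ∫ y in T.carrier, fderiv ℝ f y c =
      ∑ i, inner ℝ (T.normal i) c * ∫ y in T.facet i, f y ∂(surf d) := by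
  have hfd : Continuous (fderiv ℝ f) := hf.continuous_fderiv (by simp)
  have hfc : Continuous f := hf.continuous
  obtain ⟨x, hx⟩ := T.nonempty_interior
  have hc : Filter.Tendsto (fun t : ℝ => x + t • c) (nhdsWithin 0 (Set.Ioi 0)) (nhds x) := by
    have hc : Continuous fun t : ℝ => x + t • c := by fun_prop
    have := hc.tendsto 0
    simp only [zero_smul, add_zero] at this
    exact this.mono_left nhdsWithin_le_nhds
  obtain ⟨t, ht, ht0⟩ := ((hc.eventually (isOpen_interior.eventually_mem hx)).and
    self_mem_nhdsWithin).exists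
  have ht0 : 0 < t := ht0
  -- The radial fields with apices `x` and `x + t • c` differ by `t f c`, and the heights by `t
  -- ⟪ν_i, c⟫`.
  have h1 := setIntegral_radial (T := T) hd hf hx
  have h2 := setIntegral_radial (T := T) hd hf (x := x + t • c) ht
  have hint : ∀ x, IntegrableOn (fun y => (d : ℝ) * f y + fderiv ℝ f y (y - x)) T.carrier :=
    fun x => Continuous.continuousOn (by fun_prop) |>.integrableOn_compact T.isCompact_carrier
  have h3 := integral_sub (hint x) (hint (x + t • c))
  rw [h1, h2, ← Finset.sum_sub_distrib] at h3
  have h4 : ∀ y, (d : ℝ) * f y + fderiv ℝ f y (y - x) -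
      ((d : ℝ) * f y + fderiv ℝ f y (y - (x + t • c))) = t * fderiv ℝ f y c := fun y => by
    simp only [map_sub, map_add, map_smul, smul_eq_mul]
    ring
  simp_rw [h4] at h3
  rw [integral_const_mul] at h3
  have h5 : t * ∫ y in T.carrier, fderiv ℝ f y c =
      t * ∑ i, inner ℝ (T.normal i) c * ∫ y in T.facet i, f y ∂(surf d) := by
    rw [h3, Finset.mul_sum]
    refine Finset.sum_congr rfl fun i _ => ?_
    rw [height, height, inner_add_right, inner_smul_right]
    ring
  exact mul_left_cancel₀ ht0.ne' h5

end ConvexPolytope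

end Divergence

/-! ### Green's identities and the local consequence of a vanishing weak Laplacian. -/

section Green

variable {d : ℕ} (T : ConvexPolytope d)

theorem integral_surfOn {e : Set (E d)} (he : MeasurableSet e) (f : E d → ℝ) :
    ∫ x, f x ∂(surfOn e) = ∫ x in e, f x ∂(surf d) :=
  integral_subtype_comap he f

/-- A continuous function that is nonnegative on `s` with vanishing integral over `s` vanishes at
each point of `s` all of whose neighbourhoods meet `s` in positive measure. -/
theorem eq_zero_of_setIntegral_eq_zero {μ : Measure (E d)} {s : Set (E d)} (hs : MeasurableSet s)
    {g : E d → ℝ} (hg : Continuous g) (hnn : ∀ x ∈ s, 0 ≤ g x) (hint : IntegrableOn g s μ)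
    (h : ∫ x in s, g x ∂μ = 0) {x : E d}
    (hx : ∀ V : Set (E d), IsOpen V → x ∈ V → μ (V ∩ s) ≠ 0) : g x = 0 := by
  by_contra hne
  rw [setIntegral_eq_zero_iff_of_nonneg_ae
    ((ae_restrict_iff' hs).2 (Filter.Eventually.of_forall hnn)) hint] at h
  refine hx {y | g y ≠ 0} (isOpen_ne_fun hg continuous_const) hne ?_
  have h1 : ∀ᵐ y ∂(μ.restrict s), g y = 0 := h
  rw [ae_iff, Measure.restrict_apply (isOpen_ne_fun hg continuous_const).measurableSet] at h1
  exact h1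

namespace ConvexPolytope

theorem surf_facet_lt_top (i : Fin T.n) : surf d (T.facet i) < ⊤ := by
  obtain ⟨x, hx⟩ := T.relint_nonempty i
  rw [surf_hyperplane (T.norm_normal i) x fun y hy =>
    T.facet_normal_inner_sub i y hy x (T.relint_subset i hx)]
  have hiso : Isometry fun z : (ℝ ∙ T.normal i)ᗮ => x + (z : E d) :=
    (isometry_add_left _).comp isometry_subtype_coe
  exact (hiso.isClosedEmbedding.isCompact_preimage (T.isCompact_facet i)).measure_lt_top

/-- In the coordinates of the hyperplane, centred at `x`, the set is a neighbourhood of the origin.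
-/
theorem surf_inter_facet_ne_zero (i : Fin T.n) {x : E d} (hx : x ∈ T.relint i) {V : Set (E d)}
    (hV : IsOpen V) (hxV : x ∈ V) : surf d (V ∩ T.facet i) ≠ 0 := by
  rw [surf_hyperplane (T.norm_normal i) x fun y hy =>
    T.facet_normal_inner_sub i y hy.2 x (T.relint_subset i hx)]
  refine (Measure.measure_pos_of_mem_nhds volume (x := 0) ?_).ne'
  have hc : Continuous fun z : (ℝ ∙ T.normal i)ᗮ => x + (z : E d) := by fun_prop
  have h0 := hc.tendsto 0
  simp only [Submodule.coe_zero, add_zero] at h0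
  filter_upwards [h0.eventually (hV.eventually_mem hxV),
    h0.eventually (T.eventually_lt_of_mem_relint hx)] with z hzV hz
  refine ⟨hzV, T.relint_subset i ⟨?_, hz⟩⟩
  rw [inner_add_right, hx.1, Submodule.mem_orthogonal_singleton_iff_inner_right.1 z.2, add_zero]

theorem integrableOn_facet (i : Fin T.n) {g : E d → ℝ} (hg : Continuous g) :
    IntegrableOn g (T.facet i) (surf d) :=
  hg.continuousOn.integrableOn_of_subset_isCompact (T.isCompact_facet i)
    (T.isClosed_facet i).measurableSet subset_rfl (T.surf_facet_lt_top i).ne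

theorem integrableOn_carrier {g : E d → ℝ} (hg : Continuous g) :
    IntegrableOn g T.carrier := hg.continuousOn.integrableOn_compact T.isCompact_carrier

theorem continuous_pval_mul (p q : MvPolynomial (Fin d) ℝ) :
    Continuous fun x : E d => pval p x * pval q x := (continuous_pval p).mul (continuous_pval q)

theorem continuous_dirDeriv (p : MvPolynomial (Fin d) ℝ) (n : E d) :
    Continuous fun x => dirDeriv p n x := by
  simp_rw [← pval_dirDerivPoly]
  exact continuous_pval _

theorem continuous_pval_mul_dirDeriv (p q : MvPolynomial (Fin d) ℝ) (n : E d) :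
    Continuous fun x : E d => pval p x * dirDeriv q n x :=
  (continuous_pval p).mul (continuous_dirDeriv q n)

/-- The weight will be a bubble, which may vanish on the relative boundary of the facet; closure
recovers `q` there. -/
theorem pval_eq_zero_of_facet (i : Fin T.n) {B q : MvPolynomial (Fin d) ℝ}
    (hB : ∀ x ∈ T.facet i, 0 ≤ pval B x) (hB' : ∀ x ∈ T.relint i, 0 < pval B x)
    (h : ∫ x in T.facet i, pval B x * pval q x ^ 2 ∂(surf d) = 0) :
    ∀ x ∈ T.facet i, pval q x = 0 := by
  have hg : Continuous fun x => pval B x * pval q x ^ 2 :=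
    (continuous_pval B).mul ((continuous_pval q).pow 2)
  have h1 : ∀ x ∈ T.relint i, pval q x = 0 := fun x hx => by
    have h2 := eq_zero_of_setIntegral_eq_zero (T.isClosed_facet i).measurableSet hg
      (fun y hy => mul_nonneg (hB y hy) (sq_nonneg _)) (T.integrableOn_facet i hg) h
      (fun V hV hxV => T.surf_inter_facet_ne_zero i hx hV hxV)
    simpa [(hB' x hx).ne'] using h2
  intro x hx
  exact closure_minimal (s := T.relint i) (t := {x | pval q x = 0}) h1
    (isClosed_eq (continuous_pval q) continuous_const) (T.facet_subset_closure_relint i hx)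

theorem eq_zero_of_setIntegral_carrier {B q : MvPolynomial (Fin d) ℝ}
    (hB : ∀ x ∈ T.carrier, 0 ≤ pval B x) (hB' : ∀ x ∈ interior T.carrier, 0 < pval B x)
    (h : ∫ x in T.carrier, pval B x * pval q x ^ 2 = 0) : q = 0 := by
  have hg : Continuous fun x => pval B x * pval q x ^ 2 :=
    (continuous_pval B).mul ((continuous_pval q).pow 2)
  refine eq_zero_of_pval_eq_zero T.nonempty_interior fun x hx => ?_
  have h2 := eq_zero_of_setIntegral_eq_zero T.isClosed_carrier.measurableSet hg
    (fun y hy => mul_nonneg (hB y hy) (sq_nonneg _)) (T.integrableOn_carrier hg) h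
    (x := x) (fun V hV hxV => (Measure.measure_pos_of_mem_nhds volume
      (Filter.inter_mem (hV.mem_nhds hxV) (mem_interior_iff_mem_nhds.1 hx))).ne')
  simpa [(hB' x hx).ne'] using h2

theorem setIntegral_pderiv (hd : 0 < d) (p : MvPolynomial (Fin d) ℝ) (l : Fin d) :
    ∫ x in T.carrier, pval (MvPolynomial.pderiv l p) x =
      ∑ i, T.normal i l * ∫ x in T.facet i, pval p x ∂(surf d) := by
  have h := T.setIntegral_fderiv hd (contDiff_pval p) (EuclideanSpace.single l (1 : ℝ))
  simp_rw [fderiv_pval_apply] at h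
  simpa [dirDeriv, Pi.single_apply, EuclideanSpace.inner_single_right] using h

/-- Green's first identity on a polytope. -/
theorem green_first (hd : 0 < d) (p q : MvPolynomial (Fin d) ℝ) :
    (∑ l, ∫ x in T.carrier, pval (MvPolynomial.pderiv l p) x * pval (MvPolynomial.pderiv l q) x)
      + ∫ x in T.carrier, pval p x * pval (lap q) x =
      ∑ i, ∫ x in T.facet i, pval p x * dirDeriv q (T.normal i) x ∂(surf d) := by
  have hl : ∀ l, (∫ x in T.carrier, pval (MvPolynomial.pderiv l p) x *
      pval (MvPolynomial.pderiv l q) x) + ∫ x in T.carrier, pval p x *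
        pval (MvPolynomial.pderiv l (MvPolynomial.pderiv l q)) x =
      ∑ i, T.normal i l * ∫ x in T.facet i,
        pval p x * pval (MvPolynomial.pderiv l q) x ∂(surf d) := by
    intro l
    have h := T.setIntegral_pderiv hd (p * MvPolynomial.pderiv l q) l
    simp only [Derivation.leibniz, smul_eq_mul, pval_add, pval_mul] at h
    rw [← h, integral_add (T.integrableOn_carrier (continuous_pval_mul _ _))
      (T.integrableOn_carrier (continuous_pval_mul _ _)), add_comm]
    simp only [mul_comm]
  have h1 : ∫ x in T.carrier, pval p x * pval (lap q) x = ∑ l, ∫ x in T.carrier, pval p x *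
        pval (MvPolynomial.pderiv l (MvPolynomial.pderiv l q)) x := by
    rw [← integral_finsetSum _ fun l _ =>
      T.integrableOn_carrier (continuous_pval_mul _ _)]
    simp only [lap, pval_sum, Finset.mul_sum]
  rw [h1, ← Finset.sum_add_distrib, Finset.sum_congr rfl fun l _ => hl l, Finset.sum_comm]
  refine Finset.sum_congr rfl fun i _ => ?_
  simp only [dirDeriv, Finset.mul_sum]
  have hint : ∀ l ∈ Finset.univ, Integrable (fun x => pval p x *
      (pval (MvPolynomial.pderiv l q) x * T.normal i l)) ((surf d).restrict (T.facet i)) :=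
    fun l _ => T.integrableOn_facet i ((continuous_pval _).mul
      ((continuous_pval _).mul continuous_const))
  rw [integral_finsetSum _ hint]
  refine Finset.sum_congr rfl fun l _ => ?_
  rw [← integral_const_mul]
  simp only [mul_comm, mul_left_comm]

/-- Green's second identity on a polytope. -/
theorem green_second (hd : 0 < d) (p q : MvPolynomial (Fin d) ℝ) :
    ∫ x in T.carrier, pval p x * pval (lap q) x = (∫ x in T.carrier, pval q x * pval (lap p) x)
      + (∑ i, ∫ x in T.facet i, pval p x * dirDeriv q (T.normal i) x ∂(surf d))
      - ∑ i, ∫ x in T.facet i, pval q x * dirDeriv p (T.normal i) x ∂(surf d) := by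
  have h1 := T.green_first hd p q
  have h2 := T.green_first hd q p
  simp only [mul_comm (pval (MvPolynomial.pderiv _ q) _)] at h2
  linarith

/-- The product of the squares of the affine functions of the facets in `S`. -/
def bubble (S : Finset (Fin T.n)) : MvPolynomial (Fin d) ℝ :=
  ∏ l ∈ S, affinePoly (T.normal l) (T.offset l) ^ 2

theorem bubble_mem_Poly (S : Finset (Fin T.n)) : T.bubble S ∈ Poly d (2 * S.card) := by
  rw [MvPolynomial.mem_restrictTotalDegree]
  refine (MvPolynomial.totalDegree_finsetProd _ _).trans ?_
  rw [mul_comm]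
  refine Finset.sum_le_card_nsmul _ _ _ fun l _ => ?_
  refine (MvPolynomial.totalDegree_pow _ _).trans ?_
  have := affinePoly_mem_Poly (T.normal l) (T.offset l)
  rw [MvPolynomial.mem_restrictTotalDegree] at this
  omega

theorem pval_bubble (S : Finset (Fin T.n)) (x : E d) :
    pval (T.bubble S) x = ∏ l ∈ S, (inner ℝ (T.normal l) x - T.offset l) ^ 2 := by
  simp [bubble, pval_prod, pval_affinePoly]

theorem pval_bubble_nonneg (S : Finset (Fin T.n)) (x : E d) : 0 ≤ pval (T.bubble S) x := by
  rw [pval_bubble]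
  exact Finset.prod_nonneg fun _ _ => sq_nonneg _

theorem pval_bubble_pos {S : Finset (Fin T.n)} {x : E d}
    (h : ∀ l ∈ S, inner ℝ (T.normal l) x < T.offset l) : 0 < pval (T.bubble S) x := by
  rw [pval_bubble]
  exact Finset.prod_pos fun l hl => sq_pos_of_neg (sub_neg.2 (h l hl))

theorem pval_bubble_mul_eq_zero {S : Finset (Fin T.n)} {i : Fin T.n} (hi : i ∈ S)
    (r : MvPolynomial (Fin d) ℝ) {x : E d} (hx : x ∈ T.facet i) :
    pval (T.bubble S * r) x = 0 := by
  rw [pval_mul, pval_bubble, Finset.prod_eq_zero hi (by rw [hx.2]; ring), zero_mul]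

/-- The facet functions are squared for this purpose: the product vanishes to second order on the
facets in `S`, so as a test function it contributes neither values nor normal derivatives there. -/
theorem dirDeriv_bubble_mul_eq_zero {S : Finset (Fin T.n)} {i : Fin T.n} (hi : i ∈ S)
    (r : MvPolynomial (Fin d) ℝ) (m : E d) {x : E d} (hx : x ∈ T.facet i) :
    dirDeriv (T.bubble S * r) m x = 0 := by
  have h : T.bubble S * r = affinePoly (T.normal i) (T.offset i) *
      (affinePoly (T.normal i) (T.offset i) * (T.bubble (S.erase i) * r)) := by
    rw [bubble, bubble, ← Finset.mul_prod_erase S _ hi]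
    ring
  have h0 : pval (affinePoly (T.normal i) (T.offset i)) x = 0 := by
    rw [pval_affinePoly, hx.2, sub_self]
  rw [h, dirDeriv_mul, pval_mul, h0]
  ring

/-- If the functional that defines the weak Laplacian of `{p, pb, pn}` vanishes on `P_j(T)`, then
`p` is harmonic and `pb`, `pn` are its trace and its normal derivative. -/
theorem harmonic_of_weakLap_eq_zero (hd : 0 < d) {k j : ℕ} (hk : 2 ≤ k) (hj : k + 2 * T.n - 1 ≤ j)
    {p : MvPolynomial (Fin d) ℝ} (hp : p ∈ Poly d k)
    {pb pn : Fin T.n → MvPolynomial (Fin d) ℝ} (hpb : ∀ i, pb i ∈ Poly d k)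
    (hpn : ∀ i, pn i ∈ Poly d (k - 1))
    (h : ∀ φ ∈ Poly d j, (∫ x in T.carrier, pval p x * pval (lap φ) x)
      - (∑ i, ∫ x in T.facet i, pval (pb i) x * dirDeriv φ (T.normal i) x ∂(surf d))
      + ∑ i, ∫ x in T.facet i, pval (pn i) x * pval φ x ∂(surf d) = 0) :
    lap p = 0 ∧ (∀ i, ∀ x ∈ T.facet i, pval (pb i) x = pval p x) ∧
      ∀ i, ∀ x ∈ T.facet i, pval (pn i) x = dirDeriv p (T.normal i) x := by
  have hcard : ∀ i : Fin T.n, 2 * (Finset.univ.erase i).card = 2 * T.n - 2 := fun i => by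
    rw [Finset.card_erase_of_mem (Finset.mem_univ i), Finset.card_univ, Fintype.card_fin]
    omega
  -- Green's second identity rewrites the functional in terms of the three residuals.
  have key : ∀ φ ∈ Poly d j, (∫ x in T.carrier, pval φ x * pval (lap p) x)
      + (∑ i, ∫ x in T.facet i, (pval p x - pval (pb i) x) * dirDeriv φ (T.normal i) x ∂(surf d))
      + ∑ i, ∫ x in T.facet i, (pval (pn i) x - dirDeriv p (T.normal i) x) * pval φ x ∂(surf d)
      = 0 := by
    intro φ hφ
    rw [← h φ hφ, T.green_second hd p φ]
    simp only [sub_mul]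
    have e1 : ∀ i, ∫ x in T.facet i, (pval p x * dirDeriv φ (T.normal i) x -
        pval (pb i) x * dirDeriv φ (T.normal i) x) ∂(surf d) =
        (∫ x in T.facet i, pval p x * dirDeriv φ (T.normal i) x ∂(surf d)) -
        ∫ x in T.facet i, pval (pb i) x * dirDeriv φ (T.normal i) x ∂(surf d) := fun i =>
      integral_sub
        (T.integrableOn_facet i (continuous_pval_mul_dirDeriv _ _ _))
        (T.integrableOn_facet i (continuous_pval_mul_dirDeriv _ _ _))
    have e2 : ∀ i, ∫ x in T.facet i, (pval (pn i) x * pval φ x -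
        dirDeriv p (T.normal i) x * pval φ x) ∂(surf d) =
        (∫ x in T.facet i, pval (pn i) x * pval φ x ∂(surf d)) -
        ∫ x in T.facet i, pval φ x * dirDeriv p (T.normal i) x ∂(surf d) := fun i => by
      simp only [mul_comm (dirDeriv p _ _)]
      exact integral_sub (T.integrableOn_facet i (continuous_pval_mul _ _))
        (T.integrableOn_facet i (continuous_pval_mul_dirDeriv _ _ _))
    simp only [e1, e2, Finset.sum_sub_distrib]
    ring
  -- With the full bubble all facet terms drop, leaving a weighted integral of `(lap p)²`.
  have hlap : lap p = 0 := by
    have hφ : T.bubble Finset.univ * lap p ∈ Poly d j := by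
      refine Poly_mono ?_ (mul_mem_Poly (T.bubble_mem_Poly Finset.univ) (lap_mem_Poly hp))
      rw [Finset.card_univ, Fintype.card_fin]
      omega
    have h1 := key _ hφ
    rw [Finset.sum_eq_zero fun i _ => setIntegral_eq_zero_of_forall_eq_zero fun x hx => by
        rw [T.dirDeriv_bubble_mul_eq_zero (Finset.mem_univ i) _ _ hx, mul_zero],
      Finset.sum_eq_zero fun i _ => setIntegral_eq_zero_of_forall_eq_zero fun x hx => by
        rw [T.pval_bubble_mul_eq_zero (Finset.mem_univ i) _ hx, mul_zero]] at h1
    refine T.eq_zero_of_setIntegral_carrier (fun x _ => T.pval_bubble_nonneg Finset.univ x)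
      (fun x hx => T.pval_bubble_pos fun l _ => T.lt_of_mem_interior hx l) ?_
    simpa [mul_assoc, pow_two] using h1
  -- Omitting the `i`-th factor leaves only the terms on facet `i`.
  have single : ∀ i, ∀ r, T.bubble (Finset.univ.erase i) * r ∈ Poly d j →
      (∫ x in T.facet i, (pval p x - pval (pb i) x) *
        dirDeriv (T.bubble (Finset.univ.erase i) * r) (T.normal i) x ∂(surf d))
      + (∫ x in T.facet i, (pval (pn i) x - dirDeriv p (T.normal i) x) *
        pval (T.bubble (Finset.univ.erase i) * r) x ∂(surf d)) = 0 := by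
    intro i r hr
    have h1 := key _ hr
    simp only [hlap, pval_zero, mul_zero, integral_zero, zero_add] at h1
    rw [Finset.sum_eq_single i, Finset.sum_eq_single i] at h1
    · exact h1
    · intro l _ hl
      exact setIntegral_eq_zero_of_forall_eq_zero fun x hx => by
        rw [T.pval_bubble_mul_eq_zero (Finset.mem_erase.2 ⟨hl, Finset.mem_univ l⟩) _ hx, mul_zero]
    · simp
    · intro l _ hl
      exact setIntegral_eq_zero_of_forall_eq_zero fun x hx => by
        rw [T.dirDeriv_bubble_mul_eq_zero (Finset.mem_erase.2 ⟨hl, Finset.mem_univ l⟩) _ _ hx,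
          mul_zero]
    · simp
  have hpos : ∀ i, ∀ x ∈ T.relint i, 0 < pval (T.bubble (Finset.univ.erase i)) x :=
    fun i x hx => T.pval_bubble_pos fun l hl => hx.2 l (Finset.ne_of_mem_erase hl)
  have hb : ∀ i, ∀ x ∈ T.facet i, pval p x - pval (pb i) x = 0 := by
    intro i
    have hn : 0 < T.n := i.pos
    -- The extra affine factor is zero on facet `i` with normal derivative `1`, so the term with
    -- `pn` drops and the other becomes a weighted integral of `(p - pb)²`. The degree `2(n - 1) + 1
    -- + k` is exactly `k + 2n - 1`.
    have hφ : T.bubble (Finset.univ.erase i) *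
        (affinePoly (T.normal i) (T.offset i) * (p - pb i)) ∈ Poly d j := by
      refine Poly_mono ?_ (mul_mem_Poly (T.bubble_mem_Poly _)
        (mul_mem_Poly (affinePoly_mem_Poly _ _) (Submodule.sub_mem _ hp (hpb i))))
      rw [hcard]
      omega
    have h1 := single i _ hφ
    have h0 : ∀ x ∈ T.facet i, pval (affinePoly (T.normal i) (T.offset i)) x = 0 := fun x hx => by
      rw [pval_affinePoly, hx.2, sub_self]
    rw [setIntegral_eq_zero_of_forall_eq_zero (f := fun x => (pval (pn i) x -
      dirDeriv p (T.normal i) x) * _) fun x hx => by simp [h0 x hx], add_zero] at h1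
    simp only [← pval_sub]
    refine T.pval_eq_zero_of_facet i (fun x _ => T.pval_bubble_nonneg (Finset.univ.erase i) x)
      (hpos i) ?_
    rw [← h1]
    refine setIntegral_congr_fun (T.isClosed_facet i).measurableSet fun x hx => ?_
    simp only [dirDeriv_mul, pval_mul, h0 x hx, dirDeriv_affinePoly, real_inner_self_eq_norm_sq,
      T.norm_normal, pval_sub]
    ring
  refine ⟨hlap, fun i x hx => (sub_eq_zero.1 (hb i x hx)).symm, fun i => ?_⟩
  have hn : 0 < T.n := i.pos
  -- The trace residual is already zero, so the affine factor is no longer needed.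
  have hφ : T.bubble (Finset.univ.erase i) * (pn i - dirDerivPoly (T.normal i) p) ∈ Poly d j := by
    refine Poly_mono ?_ (mul_mem_Poly (T.bubble_mem_Poly _)
      (Submodule.sub_mem _ (hpn i) (dirDerivPoly_mem_Poly _ hp)))
    rw [hcard]
    omega
  have h1 := single i _ hφ
  rw [setIntegral_eq_zero_of_forall_eq_zero (f := fun x => (pval p x - pval (pb i) x) * _)
    fun x hx => by simp [hb i x hx], zero_add] at h1
  have h2 := T.pval_eq_zero_of_facet i (q := pn i - dirDerivPoly (T.normal i) p)
    (fun x _ => T.pval_bubble_nonneg (Finset.univ.erase i) x) (hpos i) (by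
      rw [← h1]
      refine setIntegral_congr_fun (T.isClosed_facet i).measurableSet fun x hx => ?_
      simp only [pval_mul, pval_sub, pval_dirDerivPoly]
      ring)
  intro x hx
  have h3 := h2 x hx
  rwa [pval_sub, pval_dirDerivPoly, sub_eq_zero] at h3

end ConvexPolytope

end Green

/-! ### How elements meet along facets, and cancellation of facet sums. -/

section MeshGeometry

variable {d : ℕ} {Ω : Set (E d)} {ι : Type*}

theorem ConvexPolytope.exists_mem_relint_inter {T T' : ConvexPolytope d} {i : Fin T.n}
    {i' : Fin T'.n} (h : T'.facet i' = T.facet i) : ∃ x, x ∈ T.relint i ∧ x ∈ T'.relint i' := by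
  obtain ⟨x, hx⟩ := T.relint_nonempty i
  obtain ⟨y, hy⟩ := T'.relint_nonempty i'
  refine ⟨(1 - (1 / 2 : ℝ)) • y + (1 / 2 : ℝ) • x, ?_, ?_⟩
  · exact T.lineMap_mem_relint hx (h ▸ T'.relint_subset i' hy) (by norm_num) (by norm_num)
  · have := T'.lineMap_mem_relint hy (h ▸ T.relint_subset i hx) (t := 1 / 2) (by norm_num)
      (by norm_num)
    convert this using 1
    rw [add_comm]
    norm_num

namespace Mesh

variable (M : Mesh Ω ι)

theorem normal_eq_or_eq_neg {a b : ι} {i : Fin (M.elem a).n} {i' : Fin (M.elem b).n}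
    (h : (M.elem b).facet i' = (M.elem a).facet i) :
    (M.elem b).normal i' = (M.elem a).normal i ∨ (M.elem b).normal i' = -(M.elem a).normal i :=
  (M.elem a).eq_or_eq_neg_normal i ((M.elem b).norm_normal i')
    (h ▸ (M.elem b).facet_normal_inner_sub i')

/-- Two elements on the same side of a common facet are equal. -/
theorem eq_of_normal_eq {a b : ι} {i : Fin (M.elem a).n} {i' : Fin (M.elem b).n}
    (h : (M.elem b).facet i' = (M.elem a).facet i)
    (hn : (M.elem b).normal i' = (M.elem a).normal i) : a = b := by
  by_contra hab
  obtain ⟨x, hxa, hxb⟩ := ConvexPolytope.exists_mem_relint_inter h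
  -- A small step inwards from a common relative interior point enters both interiors, which are
  -- disjoint for distinct elements.
  have hc : Filter.Tendsto (fun t : ℝ => x - t • (M.elem a).normal i)
      (nhdsWithin 0 (Set.Ioi 0)) (nhds x) := by
    have hc : Continuous fun t : ℝ => x - t • (M.elem a).normal i := by fun_prop
    have := hc.tendsto 0
    simp only [zero_smul, sub_zero] at this
    exact this.mono_left nhdsWithin_le_nhds
  obtain ⟨t, ⟨hta, htb⟩, ht0⟩ :=
    (((hc.eventually ((M.elem a).eventually_lt_of_mem_relint hxa)).and
      (hc.eventually ((M.elem b).eventually_lt_of_mem_relint hxb))).and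
      self_mem_nhdsWithin).exists
  have ht0 : 0 < t := ht0
  have h1 : inner ℝ ((M.elem a).normal i) (x - t • (M.elem a).normal i) =
      inner ℝ ((M.elem a).normal i) x - t := by
    rw [inner_sub_right, inner_smul_right, real_inner_self_eq_norm_sq, (M.elem a).norm_normal]
    ring
  refine Set.disjoint_left.1 (M.disjoint hab)
    ((M.elem a).mem_interior_of_lt (x := x - t • (M.elem a).normal i) fun j => ?_)
    ((M.elem b).mem_interior_of_lt fun j => ?_)
  · by_cases hj : j = i
    · subst hj
      rw [h1, hxa.1]
      linarith
    · exact hta j hj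
  · by_cases hj : j = i'
    · subst hj
      rw [hn, h1, ← hn, hxb.1]
      linarith
    · exact htb j hj

theorem carrier_subset_closure (a : ι) : (M.elem a).carrier ⊆ closure Ω := by
  rw [M.cover]
  exact Set.subset_iUnion (fun a => (M.elem a).carrier) a

/-- A facet with elements on both sides is not on the boundary. -/
theorem not_subset_frontier (hΩ : IsBoundedDomain Ω) {a b : ι} {i : Fin (M.elem a).n}
    {i' : Fin (M.elem b).n} (h : (M.elem b).facet i' = (M.elem a).facet i)
    (hn : (M.elem b).normal i' = -(M.elem a).normal i) :
    ¬(M.elem a).facet i ⊆ frontier Ω := by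
  intro hfr
  obtain ⟨x, hxa, hxb⟩ := ConvexPolytope.exists_mem_relint_inter h
  have hoff : (M.elem b).offset i' = -(M.elem a).offset i := by
    rw [← hxb.1, ← hxa.1, hn, inner_neg_left]
  -- Near `x` the two elements fill the two opposite half-spaces, so `x` is interior to `closure Ω`
  -- and thus, by regularity, lies in `Ω`.
  have hmem : x ∈ interior (closure Ω) := by
    rw [mem_interior_iff_mem_nhds]
    filter_upwards [(M.elem a).eventually_lt_of_mem_relint hxa,
      (M.elem b).eventually_lt_of_mem_relint hxb] with y hya hyb
    rcases le_total (inner ℝ ((M.elem a).normal i) y) ((M.elem a).offset i) with hle | hle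
    · refine M.carrier_subset_closure a fun j => ?_
      by_cases hj : j = i
      · exact hj ▸ hle
      · exact (hya j hj).le
    · refine M.carrier_subset_closure b fun j => ?_
      by_cases hj : j = i'
      · subst hj
        rw [hn, hoff, inner_neg_left]
        linarith
      · exact (hyb j hj).le
  rw [hΩ.regular] at hmem
  have hx := hfr ((M.elem a).relint_subset i hxa)
  rw [hΩ.isOpen.frontier_eq] at hx
  exact hx.2 hmem

/-- On a boundary facet the outward normal does not depend on the element, which makes Neumann data
there single-valued. -/
theorem normal_eq_of_subset_frontier (hΩ : IsBoundedDomain Ω) {a b : ι} {i : Fin (M.elem a).n}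
    {i' : Fin (M.elem b).n} (h : (M.elem b).facet i' = (M.elem a).facet i)
    (hfr : (M.elem a).facet i ⊆ frontier Ω) : (M.elem b).normal i' = (M.elem a).normal i :=
  (M.normal_eq_or_eq_neg h).resolve_right fun hn => M.not_subset_frontier hΩ h hn hfr

theorem normal_eq_neg {a b : ι} {i : Fin (M.elem a).n} {i' : Fin (M.elem b).n} (hab : b ≠ a)
    (h : (M.elem b).facet i' = (M.elem a).facet i) :
    (M.elem b).normal i' = -(M.elem a).normal i :=
  (M.normal_eq_or_eq_neg h).resolve_left fun hn => hab (M.eq_of_normal_eq h hn).symm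

/-- Sums over all facets of all elements of terms that are odd in the normal and vanish on the
boundary are zero. -/
theorem sum_facets_eq_zero [Fintype ι] (K : M.Face → E d → ℝ)
    (hodd : ∀ e n, K e (-n) = -K e n)
    (hbd : ∀ a i, (M.elem a).facet i ⊆ frontier Ω → K (M.face a i) ((M.elem a).normal i) = 0) :
    ∑ a, ∑ i, K (M.face a i) ((M.elem a).normal i) = 0 := by
  classical
  rw [Finset.sum_sigma', Finset.univ_sigma_univ]
  have hnb : ∀ s : (a : ι) × Fin (M.elem a).n, ¬(M.elem s.1).facet s.2 ⊆ frontier Ω →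
      ∃ s' : (a : ι) × Fin (M.elem a).n, s'.1 ≠ s.1 ∧
        (M.elem s'.1).facet s'.2 = (M.elem s.1).facet s.2 := fun s hs => by
    obtain ⟨b, hb, i', hi'⟩ := (M.conforming s.1 s.2).resolve_left hs
    exact ⟨⟨b, i'⟩, hb, hi'⟩
  rw [← Finset.sum_filter_add_sum_filter_not _
    (fun s : (a : ι) × Fin (M.elem a).n => (M.elem s.1).facet s.2 ⊆ frontier Ω)]
  rw [Finset.sum_eq_zero fun s hs => hbd s.1 s.2 (Finset.mem_filter.1 hs).2, zero_add]
  choose g hg1 hg2 using hnb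
  have hmem : ∀ s (hs : ¬(M.elem s.1).facet s.2 ⊆ frontier Ω),
      ¬(M.elem (g s hs).1).facet (g s hs).2 ⊆ frontier Ω := fun s hs => by rwa [hg2]
  -- An interior facet is paired with the same facet seen from the neighbour, where the normal is
  -- reversed.
  refine Finset.sum_involution (fun s hs => g s (Finset.mem_filter.1 hs).2) ?_ ?_ ?_ ?_
  · intro s hs
    have hs := (Finset.mem_filter.1 hs).2
    have hf : M.face (g s hs).1 (g s hs).2 = M.face s.1 s.2 := Subtype.ext (hg2 s hs)
    rw [hf, M.normal_eq_neg (hg1 s hs) (hg2 s hs), hodd]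
    ring
  · intro s hs _ h
    exact hg1 s (Finset.mem_filter.1 hs).2 (congrArg Sigma.fst h)
  · intro s hs
    exact Finset.mem_filter.2 ⟨Finset.mem_univ _, hmem s (Finset.mem_filter.1 hs).2⟩
  · intro s hs
    have hs := (Finset.mem_filter.1 hs).2
    change g (g s hs) (hmem s hs) = s
    have h1 := hg2 (g s hs) (hmem s hs)
    -- The neighbour of the neighbour shares the facet and, after two sign changes, the normal, so
    -- it is the original element.
    have h2 : (M.elem (g (g s hs) (hmem s hs)).1).normal (g (g s hs) (hmem s hs)).2 =
        (M.elem s.1).normal s.2 := by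
      rw [M.normal_eq_neg (hg1 _ _) h1, M.normal_eq_neg (hg1 s hs) (hg2 s hs), neg_neg]
    have h3 := h1.trans (hg2 s hs)
    have h4 := M.eq_of_normal_eq h3 h2
    generalize g (g s hs) (hmem s hs) = s'' at h3 h4
    obtain ⟨a, i⟩ := s
    obtain ⟨b, i'⟩ := s''
    dsimp only at h3 h4
    subst h4
    rw [(M.elem a).facet_injective h3]

end Mesh

end MeshGeometry

/-! ### Solvability from definiteness. -/

section LinearAlgebra

/-- Definiteness makes `B` injective into the dual, which has the same dimension; no symmetry is
needed. -/
theorem existsUnique_of_definite {W : Type*} [AddCommGroup W] [Module ℝ W] [FiniteDimensional ℝ W]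
    (B : W →ₗ[ℝ] W →ₗ[ℝ] ℝ) (hB : ∀ w, B w w = 0 → w = 0) (R : W →ₗ[ℝ] ℝ) :
    ∃! w, ∀ v, B w v = R v := by
  have hinj : Function.Injective B := (injective_iff_map_eq_zero B).2 fun w hw =>
    hB w (by rw [hw, LinearMap.zero_apply])
  have hsurj : Function.Surjective B :=
    (LinearMap.injective_iff_surjective_of_finrank_eq_finrank
      (Subspace.dual_finrank_eq (K := ℝ) (V := W)).symm).1 hinj
  obtain ⟨w, hw⟩ := hsurj R
  exact ⟨w, fun v => by rw [hw], fun w' hw' => hinj (by rw [hw]; exact LinearMap.ext hw')⟩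

end LinearAlgebra

/-! ### Integrability of the data and the L² projections on facets. -/

section FaceIntegrals

variable {d : ℕ} {Ω : Set (E d)} {ι : Type*}

theorem exists_of_mem_PolyOn {m : ℕ} {e : Set (E d)} {q : e → ℝ} (hq : q ∈ PolyOn m e) :
    ∃ p ∈ Poly d m, ∀ x : e, q x = pval p x := by
  obtain ⟨p, hp, rfl⟩ := hq
  exact ⟨p, hp, fun x => rfl⟩

theorem finiteDimensional_PolyOn (m : ℕ) (e : Set (E d)) : FiniteDimensional ℝ (PolyOn m e) := by
  unfold PolyOn
  infer_instance

namespace Mesh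

variable (M : Mesh Ω ι)

theorem measurableSet_face (e : M.Face) : MeasurableSet e.1 := by
  obtain ⟨_, a, i, rfl⟩ := e
  exact ((M.elem a).isClosed_facet i).measurableSet

theorem integrable_face (e : M.Face) {G : E d → ℝ} (hG : Continuous G) :
    Integrable (fun x : e.1 => G x) (surfOn e.1) := by
  have h := M.measurableSet_face e
  obtain ⟨_, a, i, rfl⟩ := e
  exact (integrableOn_iff_comap_subtypeVal h).1 ((M.elem a).integrableOn_facet i hG)

theorem integrable_face_mul (e : M.Face) {m : ℕ} {q : e.1 → ℝ} (hq : q ∈ PolyOn m e.1)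
    {G : E d → ℝ} (hG : Continuous G) : Integrable (fun x => q x * G x) (surfOn e.1) := by
  obtain ⟨p, -, hp⟩ := exists_of_mem_PolyOn hq
  simp_rw [hp]
  exact M.integrable_face e ((continuous_pval p).mul hG)

theorem integrable_face_mul_mul (e : M.Face) {m m' : ℕ} {q p : e.1 → ℝ} (hq : q ∈ PolyOn m e.1)
    (hp : p ∈ PolyOn m' e.1) : Integrable (fun x => q x * p x) (surfOn e.1) := by
  obtain ⟨P, -, hP⟩ := exists_of_mem_PolyOn hp
  simp_rw [hP]
  exact M.integrable_face_mul e hq (continuous_pval P)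

theorem eq_zero_of_integral_face (e : M.Face) {m : ℕ} {q : e.1 → ℝ} (hq : q ∈ PolyOn m e.1)
    (h : ∫ x, q x * q x ∂(surfOn e.1) = 0) : q = 0 := by
  obtain ⟨p, -, hp⟩ := exists_of_mem_PolyOn hq
  simp_rw [hp] at h
  rw [integral_surfOn (M.measurableSet_face e) fun x => pval p x * pval p x] at h
  obtain ⟨_, a, i, rfl⟩ := e
  funext x
  rw [hp, Pi.zero_apply]
  exact (M.elem a).pval_eq_zero_of_facet i (B := 1) (by simp) (by simp)
    (by simpa [pow_two] using h) x x.2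

theorem integrable_boundary_mul {g : E d → ℝ} (hg : MemLp g 2 ((surf d).restrict (frontier Ω)))
    (e : M.Face) (he : e.1 ⊆ frontier Ω) {m : ℕ} {p : e.1 → ℝ} (hp : p ∈ PolyOn m e.1) :
    Integrable (fun x : e.1 => g x * p x) (surfOn e.1) := by
  obtain ⟨P, -, hP⟩ := exists_of_mem_PolyOn hp
  simp_rw [hP]
  have h := M.measurableSet_face e
  obtain ⟨_, a, i, rfl⟩ := e
  refine (integrableOn_iff_comap_subtypeVal (f := fun x => g x * pval P x) h).1 ?_
  have hfin : IsFiniteMeasure ((surf d).restrict ((M.elem a).facet i)) :=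
    ⟨by simpa using (M.elem a).surf_facet_lt_top i⟩
  have h1 : IntegrableOn g ((M.elem a).facet i) (surf d) :=
    (hg.mono_measure (Measure.restrict_mono_set _ he)).integrable (by norm_num)
  exact h1.mul_continuousOn (continuous_pval P).continuousOn ((M.elem a).isCompact_facet i)

theorem integrableOn_carrier_mul (hΩ : IsBoundedDomain Ω) {f : E d → ℝ}
    (hf : MemLp f 2 (volume.restrict Ω)) (a : ι) (p : MvPolynomial (Fin d) ℝ) :
    IntegrableOn (fun x => f x * pval p x) (M.elem a).carrier := by
  -- Only the interior of the element need lie in `Ω`; its boundary is null because the element is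
  -- convex.
  have hsub : interior (M.elem a).carrier ⊆ Ω :=
    (interior_mono (M.carrier_subset_closure a)).trans hΩ.regular.subset
  have hae : (interior (M.elem a).carrier : Set (E d)) =ᵐ[volume] (M.elem a).carrier :=
    interior_ae_eq_of_null_frontier ((M.elem a).convex_carrier.addHaar_frontier volume)
  have hle : volume.restrict (M.elem a).carrier ≤ volume.restrict Ω := by
    rw [← Measure.restrict_congr_set hae]
    exact Measure.restrict_mono_set _ hsub
  have hfin : IsFiniteMeasure (volume.restrict (M.elem a).carrier) :=
    ⟨by simpa using (M.elem a).isCompact_carrier.measure_lt_top⟩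
  have h1 : IntegrableOn f (M.elem a).carrier := (hf.mono_measure hle).integrable (by norm_num)
  exact h1.mul_continuousOn (continuous_pval p).continuousOn (M.elem a).isCompact_carrier

/-- Uniqueness holds pointwise on `e`, not just almost everywhere, since a polynomial of zero L²
norm vanishes on the whole facet. -/
theorem existsUnique_isL2Projection {g : E d → ℝ}
    (hg : MemLp g 2 ((surf d).restrict (frontier Ω))) (e : M.Face) (he : e.1 ⊆ frontier Ω)
    (m : ℕ) : ∃! q, IsL2Projection m e.1 g q := by
  have := finiteDimensional_PolyOn m e.1
  let B : PolyOn m e.1 →ₗ[ℝ] PolyOn m e.1 →ₗ[ℝ] ℝ := LinearMap.mk₂ ℝ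
    (fun q p => ∫ x, q.1 x * p.1 x ∂(surfOn e.1))
    (fun q q' p => by
      simp only [Submodule.coe_add, Pi.add_apply, add_mul]
      exact integral_add (M.integrable_face_mul_mul e q.2 p.2)
        (M.integrable_face_mul_mul e q'.2 p.2))
    (fun c q p => by
      simp only [Submodule.coe_smul, Pi.smul_apply, smul_eq_mul, mul_assoc, integral_const_mul])
    (fun q p p' => by
      simp only [Submodule.coe_add, Pi.add_apply, mul_add]
      exact integral_add (M.integrable_face_mul_mul e q.2 p.2)
        (M.integrable_face_mul_mul e q.2 p'.2))
    (fun c q p => by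
      simp only [Submodule.coe_smul, Pi.smul_apply, smul_eq_mul, mul_left_comm _ c,
        integral_const_mul])
  let R : PolyOn m e.1 →ₗ[ℝ] ℝ :=
    { toFun p := ∫ x, g x * p.1 x ∂(surfOn e.1)
      map_add' p p' := by
        simp only [Submodule.coe_add, Pi.add_apply, mul_add]
        exact integral_add (M.integrable_boundary_mul hg e he p.2)
          (M.integrable_boundary_mul hg e he p'.2)
      map_smul' c p := by
        simp only [Submodule.coe_smul, Pi.smul_apply, smul_eq_mul, mul_left_comm _ c,
          integral_const_mul, RingHom.id_apply] }
  obtain ⟨q, hq, hu⟩ := existsUnique_of_definite B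
    (fun q hq => Subtype.ext (M.eq_zero_of_integral_face e q.2 hq)) R
  exact ⟨q.1, ⟨q.2, fun p hp => hq ⟨p, hp⟩⟩, fun q' hq' =>
    congrArg Subtype.val (hu ⟨q', hq'.1⟩ fun p => hq'.2 p.1 p.2)⟩

end Mesh

end FaceIntegrals

/-! ### The weak Laplacian, its linearity, and the bilinear form. -/

section WeakLaplacian

variable {d : ℕ} {Ω : Set (E d)} {ι : Type*} (M : Mesh Ω ι) {k : ℕ} (ne : M.Face → E d)

namespace Mesh

theorem vb_mem (v : M.V k) (e : M.Face) : M.vb v e ∈ PolyOn k e.1 := (v.2.1 e).2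

theorem vn_mem (v : M.V k) (e : M.Face) : M.vn v e ∈ PolyOn (k - 1) e.1 := (v.2.2 e).2

theorem v0_mem (v : M.V k) (a : ι) : M.v0 v a ∈ Poly d k := (v.1 a).2

theorem vnn_mem (v : M.V k) (a : ι) (i : Fin (M.elem a).n) :
    M.vnn ne v a i ∈ PolyOn (k - 1) (M.face a i).1 := by
  have h : M.vnn ne v a i = (inner ℝ (ne (M.face a i)) ((M.elem a).normal i) : ℝ) •
      M.vn v (M.face a i) := by
    funext x
    simp [vnn, mul_comm]
  rw [h]
  exact Submodule.smul_mem _ _ (M.vn_mem v _)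

theorem v0_add (v v' : M.V k) (a : ι) : M.v0 (v + v') a = M.v0 v a + M.v0 v' a := rfl
theorem vb_add (v v' : M.V k) (e : M.Face) : M.vb (v + v') e = M.vb v e + M.vb v' e := rfl
theorem vn_add (v v' : M.V k) (e : M.Face) : M.vn (v + v') e = M.vn v e + M.vn v' e := rfl
theorem v0_smul (c : ℝ) (v : M.V k) (a : ι) : M.v0 (c • v) a = c • M.v0 v a := rfl
theorem vb_smul (c : ℝ) (v : M.V k) (e : M.Face) : M.vb (c • v) e = c • M.vb v e := rfl
theorem vn_smul (c : ℝ) (v : M.V k) (e : M.Face) : M.vn (c • v) e = c • M.vn v e := rfl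

theorem vnn_add (v v' : M.V k) (a : ι) (i : Fin (M.elem a).n) :
    M.vnn ne (v + v') a i = M.vnn ne v a i + M.vnn ne v' a i := by
  funext x
  simp [vnn, vn_add, add_mul]

theorem vnn_smul (c : ℝ) (v : M.V k) (a : ι) (i : Fin (M.elem a).n) :
    M.vnn ne (c • v) a i = c • M.vnn ne v a i := by
  funext x
  simp [vnn, vn_smul, mul_assoc]

theorem weakLapRHS_add_right (v : M.V k) (a : ι) (φ ψ : MvPolynomial (Fin d) ℝ) :
    M.weakLapRHS ne v a (φ + ψ) = M.weakLapRHS ne v a φ + M.weakLapRHS ne v a ψ := by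
  have h1 := integral_add
    ((M.elem a).integrableOn_carrier (ConvexPolytope.continuous_pval_mul (M.v0 v a) (lap φ)))
    ((M.elem a).integrableOn_carrier (ConvexPolytope.continuous_pval_mul (M.v0 v a) (lap ψ)))
  have h2 := fun i => integral_add (M.integrable_face_mul (M.face a i) (M.vb_mem v _)
      (ConvexPolytope.continuous_dirDeriv φ ((M.elem a).normal i)))
    (M.integrable_face_mul (M.face a i) (M.vb_mem v _)
      (ConvexPolytope.continuous_dirDeriv ψ ((M.elem a).normal i)))
  have h3 := fun i => integral_add
    (M.integrable_face_mul (M.face a i) (M.vnn_mem ne v a i) (continuous_pval φ))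
    (M.integrable_face_mul (M.face a i) (M.vnn_mem ne v a i) (continuous_pval ψ))
  simp only [weakLapRHS, lap_add, pval_add, dirDeriv_add, mul_add, h1, h2, h3,
    Finset.sum_add_distrib]
  ring

theorem weakLapRHS_smul_right (v : M.V k) (a : ι) (c : ℝ) (φ : MvPolynomial (Fin d) ℝ) :
    M.weakLapRHS ne v a (c • φ) = c * M.weakLapRHS ne v a φ := by
  simp only [weakLapRHS, lap_smul, pval_smul, dirDeriv_smul, mul_left_comm _ c,
    integral_const_mul, ← Finset.mul_sum]
  ring

theorem weakLapRHS_add_left (v v' : M.V k) (a : ι) (φ : MvPolynomial (Fin d) ℝ) :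
    M.weakLapRHS ne (v + v') a φ = M.weakLapRHS ne v a φ + M.weakLapRHS ne v' a φ := by
  have h1 := integral_add
    ((M.elem a).integrableOn_carrier (ConvexPolytope.continuous_pval_mul (M.v0 v a) (lap φ)))
    ((M.elem a).integrableOn_carrier (ConvexPolytope.continuous_pval_mul (M.v0 v' a) (lap φ)))
  have h2 := fun i => integral_add (M.integrable_face_mul (M.face a i) (M.vb_mem v _)
      (ConvexPolytope.continuous_dirDeriv φ ((M.elem a).normal i)))
    (M.integrable_face_mul (M.face a i) (M.vb_mem v' _)
      (ConvexPolytope.continuous_dirDeriv φ ((M.elem a).normal i)))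
  have h3 := fun i => integral_add
    (M.integrable_face_mul (M.face a i) (M.vnn_mem ne v a i) (continuous_pval φ))
    (M.integrable_face_mul (M.face a i) (M.vnn_mem ne v' a i) (continuous_pval φ))
  simp only [weakLapRHS, v0_add, vb_add, vnn_add, Pi.add_apply, pval_add, add_mul, h1, h2, h3,
    Finset.sum_add_distrib]
  ring

theorem weakLapRHS_smul_left (v : M.V k) (a : ι) (c : ℝ) (φ : MvPolynomial (Fin d) ℝ) :
    M.weakLapRHS ne (c • v) a φ = c * M.weakLapRHS ne v a φ := by
  simp only [weakLapRHS, v0_smul, vb_smul, vnn_smul, Pi.smul_apply, smul_eq_mul, pval_smul,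
    mul_assoc, integral_const_mul, ← Finset.mul_sum]
  ring

theorem setIntegral_mul_add (a : ι) (p q r : MvPolynomial (Fin d) ℝ) :
    ∫ x in (M.elem a).carrier, pval p x * pval (q + r) x =
      (∫ x in (M.elem a).carrier, pval p x * pval q x) +
        ∫ x in (M.elem a).carrier, pval p x * pval r x := by
  simp only [pval_add, mul_add]
  exact integral_add
    ((M.elem a).integrableOn_carrier (ConvexPolytope.continuous_pval_mul p q))
    ((M.elem a).integrableOn_carrier (ConvexPolytope.continuous_pval_mul p r))

theorem setIntegral_add_mul (a : ι) (p q r : MvPolynomial (Fin d) ℝ) :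
    ∫ x in (M.elem a).carrier, pval (p + q) x * pval r x =
      (∫ x in (M.elem a).carrier, pval p x * pval r x) +
        ∫ x in (M.elem a).carrier, pval q x * pval r x := by
  simp only [mul_comm _ (pval r _), setIntegral_mul_add]

theorem setIntegral_mul_smul (a : ι) (c : ℝ) (p q : MvPolynomial (Fin d) ℝ) :
    ∫ x in (M.elem a).carrier, pval p x * pval (c • q) x =
      c * ∫ x in (M.elem a).carrier, pval p x * pval q x := by
  simp only [pval_smul, mul_left_comm _ c, integral_const_mul]

theorem setIntegral_smul_mul (a : ι) (c : ℝ) (p q : MvPolynomial (Fin d) ℝ) :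
    ∫ x in (M.elem a).carrier, pval (c • p) x * pval q x =
      c * ∫ x in (M.elem a).carrier, pval p x * pval q x := by
  simp only [pval_smul, mul_assoc, integral_const_mul]

/-- The weak Laplacian is well defined. -/
theorem existsUnique_isWeakLap (j : ℕ) (v : M.V k) (a : ι) : ∃! w, M.IsWeakLap ne j v a w := by
  let B : Poly d j →ₗ[ℝ] Poly d j →ₗ[ℝ] ℝ := LinearMap.mk₂ ℝ
    (fun w φ => ∫ x in (M.elem a).carrier, pval w.1 x * pval φ.1 x)
    (fun w w' φ => M.setIntegral_add_mul a _ _ _) (fun c w φ => M.setIntegral_smul_mul a _ _ _)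
    (fun w φ φ' => M.setIntegral_mul_add a _ _ _) (fun c w φ => M.setIntegral_mul_smul a _ _ _)
  let R : Poly d j →ₗ[ℝ] ℝ :=
    { toFun φ := M.weakLapRHS ne v a φ.1
      map_add' φ φ' := M.weakLapRHS_add_right ne v a _ _
      map_smul' c φ := M.weakLapRHS_smul_right ne v a _ _ }
  obtain ⟨w, hw, hu⟩ := existsUnique_of_definite B (fun w hw =>
    Subtype.ext ((M.elem a).eq_zero_of_setIntegral_carrier (B := 1) (by simp) (by simp)
      (by simpa [pow_two] using! hw))) R
  exact ⟨w.1, ⟨w.2, fun φ hφ => hw ⟨φ, hφ⟩⟩, fun w' hw' =>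
    congrArg Subtype.val (hu ⟨w', hw'.1⟩ fun φ => hw'.2 φ.1 φ.2)⟩

theorem isWeakLap_weakLap (j : ℕ) (v : M.V k) (a : ι) :
    M.IsWeakLap ne j v a (M.weakLap ne j v a) :=
  Classical.epsilon_spec (M.existsUnique_isWeakLap ne j v a).exists

/-- By uniqueness: the sum of the weak Laplacians satisfies the equation of the sum. -/
theorem weakLap_add (j : ℕ) (v v' : M.V k) (a : ι) :
    M.weakLap ne j (v + v') a = M.weakLap ne j v a + M.weakLap ne j v' a := by
  refine (M.existsUnique_isWeakLap ne j (v + v') a).unique (M.isWeakLap_weakLap ne j _ a)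
    ⟨Submodule.add_mem _ (M.isWeakLap_weakLap ne j v a).1 (M.isWeakLap_weakLap ne j v' a).1,
      fun φ hφ => ?_⟩
  rw [setIntegral_add_mul, (M.isWeakLap_weakLap ne j v a).2 φ hφ,
    (M.isWeakLap_weakLap ne j v' a).2 φ hφ, weakLapRHS_add_left]

theorem weakLap_smul (j : ℕ) (c : ℝ) (v : M.V k) (a : ι) :
    M.weakLap ne j (c • v) a = c • M.weakLap ne j v a := by
  refine (M.existsUnique_isWeakLap ne j (c • v) a).unique (M.isWeakLap_weakLap ne j _ a)
    ⟨Submodule.smul_mem _ _ (M.isWeakLap_weakLap ne j v a).1, fun φ hφ => ?_⟩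
  rw [setIntegral_smul_mul, (M.isWeakLap_weakLap ne j v a).2 φ hφ, weakLapRHS_smul_left]

/-- The bilinear form of the scheme. -/
def form [Fintype ι] (j : ℕ) : M.V k →ₗ[ℝ] M.V k →ₗ[ℝ] ℝ := LinearMap.mk₂ ℝ
  (fun u v => ∑ a, ∫ x in (M.elem a).carrier,
    pval (M.weakLap ne j u a) x * pval (M.weakLap ne j v a) x)
  (fun u u' v => by simp only [weakLap_add, setIntegral_add_mul, Finset.sum_add_distrib])
  (fun c u v => by simp only [weakLap_smul, setIntegral_smul_mul, ← Finset.mul_sum, smul_eq_mul])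
  (fun u v v' => by simp only [weakLap_add, setIntegral_mul_add, Finset.sum_add_distrib])
  (fun c u v => by simp only [weakLap_smul, setIntegral_mul_smul, ← Finset.mul_sum, smul_eq_mul])

theorem form_apply [Fintype ι] (j : ℕ) (u v : M.V k) :
    M.form ne j u v = ∑ a, ∫ x in (M.elem a).carrier,
      pval (M.weakLap ne j u a) x * pval (M.weakLap ne j v a) x := rfl

/-- The subspace `V_h^0`. -/
def subspaceV0 : Submodule ℝ (M.V k) where
  carrier := {v | M.IsV0 ne v}
  zero_mem' a i _ := ⟨fun _ => rfl, fun x => zero_mul _⟩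
  add_mem' {v v'} hv hv' a i h := by
    refine ⟨fun x => ?_, fun x => ?_⟩
    · rw [vb_add, Pi.add_apply, (hv a i h).1, (hv' a i h).1, add_zero]
    · rw [vnn_add, Pi.add_apply, (hv a i h).2, (hv' a i h).2, add_zero]
  smul_mem' c v hv a i h := by
    refine ⟨fun x => ?_, fun x => ?_⟩
    · rw [vb_smul, Pi.smul_apply, (hv a i h).1, smul_zero]
    · rw [vnn_smul, Pi.smul_apply, (hv a i h).2, smul_zero]

theorem finite_face [Finite ι] : Finite M.Face :=
  Finite.of_surjective (fun s : (a : ι) × Fin (M.elem a).n => M.face s.1 s.2) fun e => by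
    obtain ⟨e, a, i, rfl⟩ := e
    exact ⟨⟨a, i⟩, rfl⟩

theorem finiteDimensional_V [Finite ι] : FiniteDimensional ℝ (M.V k) := by
  have := M.finite_face
  have h : ∀ (m : ℕ) (e : M.Face), FiniteDimensional ℝ (PolyOn m e.1) := fun m e =>
    finiteDimensional_PolyOn m e.1
  infer_instance

end Mesh

end WeakLaplacian

/-! ### Definiteness on `V_h^0` and unique solvability. -/

section Solvability

variable {d : ℕ} {Ω : Set (E d)} {ι : Type*} (M : Mesh Ω ι) {k : ℕ} (ne : M.Face → E d)

namespace Mesh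

/-- An element with vanishing weak Laplacian is harmonic on each element, with matching trace and
normal derivative. -/
theorem harmonic_of_weakLap_eq_zero (hd : 0 < d) {j : ℕ} (hk : 2 ≤ k) (a : ι)
    (hj : k + 2 * (M.elem a).n - 1 ≤ j) {v : M.V k} (hv : M.weakLap ne j v a = 0) :
    lap (M.v0 v a) = 0 ∧ (∀ i, ∀ x, M.vb v (M.face a i) x = pval (M.v0 v a) x.1) ∧
      ∀ i, ∀ x, M.vnn ne v a i x = dirDeriv (M.v0 v a) ((M.elem a).normal i) x.1 := by
  choose pb hpb hpb' using fun i => exists_of_mem_PolyOn (M.vb_mem v (M.face a i))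
  choose pn hpn hpn' using fun i => exists_of_mem_PolyOn (M.vnn_mem ne v a i)
  have h : ∀ φ ∈ Poly d j, M.weakLapRHS ne v a φ = 0 := fun φ hφ => by
    rw [← (M.isWeakLap_weakLap ne j v a).2 φ hφ, hv]
    simp
  have hb := fun (φ : MvPolynomial (Fin d) ℝ) i => integral_surfOn
    (M.measurableSet_face (M.face a i)) fun x => pval (pb i) x * dirDeriv φ ((M.elem a).normal i) x
  have hn := fun (φ : MvPolynomial (Fin d) ℝ) i => integral_surfOn
    (M.measurableSet_face (M.face a i)) fun x => pval (pn i) x * pval φ x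
  simp only [weakLapRHS, hpb', hpn', hb, hn] at h
  obtain ⟨h1, h2, h3⟩ := (M.elem a).harmonic_of_weakLap_eq_zero hd hk hj (M.v0_mem v a) hpb hpn h
  exact ⟨h1, fun i x => by rw [hpb', h2 i x.1 x.2], fun i x => by rw [hpn', h3 i x.1 x.2]⟩

theorem inner_normal_eq (hne : M.IsNormalField ne) (a : ι) (i : Fin (M.elem a).n) :
    (inner ℝ (ne (M.face a i)) ((M.elem a).normal i) : ℝ) = 1 ∨
      (inner ℝ (ne (M.face a i)) ((M.elem a).normal i) : ℝ) = -1 := by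
  have h := hne (M.face a i)
  have hs : inner ℝ ((M.elem a).normal i) ((M.elem a).normal i) = (1 : ℝ) := by
    rw [real_inner_self_eq_norm_sq, (M.elem a).norm_normal, one_pow]
  rcases (M.elem a).eq_or_eq_neg_normal i h.1 h.2 with h | h <;> rw [h]
  · exact Or.inl hs
  · rw [inner_neg_left, hs]
    exact Or.inr rfl

/-- Boundary data can be lifted to `V_h`. -/
theorem exists_boundary_lift (hΩ : IsBoundedDomain Ω) (hne : M.IsNormalField ne) {g φ : E d → ℝ}
    (hg : MemLp g 2 ((surf d).restrict (frontier Ω)))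
    (hφ : MemLp φ 2 ((surf d).restrict (frontier Ω))) :
    ∃ u : M.V k, ∀ a i, (M.elem a).facet i ⊆ frontier Ω →
      IsL2Projection k (M.face a i).1 g (M.vb u (M.face a i)) ∧
      IsL2Projection (k - 1) (M.face a i).1 φ (M.vnn ne u a i) := by
  have hb : ∀ e : M.Face, ∃ q : PolyOn k e.1, e.1 ⊆ frontier Ω → IsL2Projection k e.1 g q := by
    intro e
    by_cases he : e.1 ⊆ frontier Ω
    · obtain ⟨q, hq⟩ := (M.existsUnique_isL2Projection hg e he k).exists
      exact ⟨⟨q, hq.1⟩, fun _ => hq⟩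
    · exact ⟨0, fun h => absurd h he⟩
  have hn : ∀ e : M.Face, ∃ q : PolyOn (k - 1) e.1, e.1 ⊆ frontier Ω →
      ∀ a i, M.face a i = e → IsL2Projection (k - 1) e.1 φ
        fun x => q.1 x * inner ℝ (ne e) ((M.elem a).normal i) := by
    intro e
    by_cases he : e.1 ⊆ frontier Ω
    · obtain ⟨q, hq⟩ := (M.existsUnique_isL2Projection hφ e he (k - 1)).exists
      obtain ⟨e, a, i, rfl⟩ := e
      -- The factor `n_e · n` is `±1`, hence its own inverse, and every element with this boundary
      -- facet gives the same sign.
      refine ⟨(inner ℝ (ne (M.face a i)) ((M.elem a).normal i) : ℝ) • ⟨q, hq.1⟩,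
        fun _ b i' hb => ?_⟩
      rw [M.normal_eq_of_subset_frontier hΩ (congrArg Subtype.val hb) he]
      convert hq using 1
      funext x
      change (inner ℝ (ne (M.face a i)) ((M.elem a).normal i) : ℝ) * q x *
        inner ℝ (ne (M.face a i)) ((M.elem a).normal i) = q x
      rcases M.inner_normal_eq ne hne a i with h2 | h2 <;> rw [h2] <;> ring
    · exact ⟨0, fun h => absurd h he⟩
  choose qb hqb using hb
  choose qn hqn using hn
  exact ⟨⟨0, qb, qn⟩, fun a i hfr => ⟨hqb _ hfr, hqn (M.face a i) hfr a i rfl⟩⟩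

variable [Fintype ι]

/-- The bilinear form of the scheme is definite on `V_h^0`. -/
theorem eq_zero_of_form_self (hd : 0 < d) (hne : M.IsNormalField ne)
    {j : ℕ} (hk : 2 ≤ k) (hj : ∀ a, k + 2 * (M.elem a).n - 1 ≤ j) {v : M.V k}
    (hv : M.IsV0 ne v) (h : M.form ne j v v = 0) : v = 0 := by
  have hw : ∀ a, M.weakLap ne j v a = 0 := by
    intro a
    rw [form_apply, Finset.sum_eq_zero_iff_of_nonneg fun a _ =>
      integral_nonneg fun x => mul_self_nonneg _] at h
    exact (M.elem a).eq_zero_of_setIntegral_carrier (B := 1) (by simp) (by simp)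
      (by simpa [pow_two] using h a (Finset.mem_univ a))
  have harm := fun a => M.harmonic_of_weakLap_eq_zero ne hd hk a (hj a) (hw a)
  -- The energy of `v_0` reduces to sums over the facets, which cancel.
  have hgrad : ∀ a l, MvPolynomial.pderiv l (M.v0 v a) = 0 := by
    have hsum : ∑ a, ∑ l, ∫ x in (M.elem a).carrier, pval (MvPolynomial.pderiv l (M.v0 v a)) x *
        pval (MvPolynomial.pderiv l (M.v0 v a)) x = 0 := by
      rw [← M.sum_facets_eq_zero
        (fun e n => ∫ x, M.vb v e x * (M.vn v e x * inner ℝ (ne e) n) ∂(surfOn e.1)) (fun e n => by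
          simp only [inner_neg_right, mul_neg, integral_neg])
        (fun a i hfr => by simp [(hv a i hfr).1])]
      refine Finset.sum_congr rfl fun a _ => ?_
      have hg := (M.elem a).green_first hd (M.v0 v a) (M.v0 v a)
      rw [(harm a).1] at hg
      simp only [pval_zero, mul_zero, integral_zero, add_zero] at hg
      rw [hg]
      refine Finset.sum_congr rfl fun i _ => ?_
      rw [← integral_surfOn ((M.elem a).isClosed_facet i).measurableSet fun x =>
        pval (M.v0 v a) x * dirDeriv (M.v0 v a) ((M.elem a).normal i) x]
      refine integral_congr_ae (Filter.Eventually.of_forall fun x => ?_)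
      dsimp only
      rw [← (harm a).2.1 i x, ← (harm a).2.2 i x]
      rfl
    intro a l
    have hnn : ∀ a l, 0 ≤ ∫ x in (M.elem a).carrier, pval (MvPolynomial.pderiv l (M.v0 v a)) x *
        pval (MvPolynomial.pderiv l (M.v0 v a)) x := fun a l =>
      integral_nonneg fun x => mul_self_nonneg _
    rw [Finset.sum_eq_zero_iff_of_nonneg fun a _ => Finset.sum_nonneg fun l _ => hnn a l] at hsum
    have h1 := hsum a (Finset.mem_univ a)
    rw [Finset.sum_eq_zero_iff_of_nonneg fun l _ => hnn a l] at h1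
    exact (M.elem a).eq_zero_of_setIntegral_carrier (B := 1) (by simp) (by simp)
      (by simpa [pow_two] using h1 l (Finset.mem_univ l))
  -- The gradient of `v_0` is zero on each element, so `∂_l (v_0² x_l) = v_0²`. The flux `n_l v_b²
  -- x_l` is odd in the normal and vanishes on `∂Ω`, so all constants vanish at once, with no
  -- passage from element to element.
  have hv0 : ∀ a, M.v0 v a = 0 := by
    let l : Fin d := ⟨0, hd⟩
    have hsum : ∑ a, ∫ x in (M.elem a).carrier, pval (M.v0 v a) x * pval (M.v0 v a) x = 0 := by
      rw [← M.sum_facets_eq_zero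
        (fun e n => n l * ∫ x, M.vb v e x * M.vb v e x * x.1 l ∂(surfOn e.1)) (fun e n => by simp)
        (fun a i hfr => by simp [(hv a i hfr).1])]
      refine Finset.sum_congr rfl fun a _ => ?_
      have hg := (M.elem a).setIntegral_pderiv hd (M.v0 v a * M.v0 v a * MvPolynomial.X l) l
      simp only [Derivation.leibniz, hgrad, smul_eq_mul, mul_zero, add_zero, MvPolynomial.pderiv_X_self,
        mul_one, pval_mul, pval_X] at hg
      rw [hg]
      refine Finset.sum_congr rfl fun i _ => ?_
      rw [← integral_surfOn ((M.elem a).isClosed_facet i).measurableSet fun x =>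
        pval (M.v0 v a) x * pval (M.v0 v a) x * x l]
      congr 1
      refine integral_congr_ae (Filter.Eventually.of_forall fun x => ?_)
      dsimp only
      rw [← (harm a).2.1 i x]
    intro a
    rw [Finset.sum_eq_zero_iff_of_nonneg fun a _ =>
      integral_nonneg fun x => mul_self_nonneg _] at hsum
    exact (M.elem a).eq_zero_of_setIntegral_carrier (B := 1) (by simp) (by simp)
      (by simpa [pow_two] using hsum a (Finset.mem_univ a))
  refine Prod.ext (funext fun a => Subtype.ext (hv0 a)) (Prod.ext (funext fun e => ?_)
    (funext fun e => ?_))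
  · obtain ⟨e, a, i, rfl⟩ := e
    refine Subtype.ext (funext fun x => ?_)
    have h1 := (harm a).2.1 i x
    rw [hv0 a, pval_zero] at h1
    exact h1
  · obtain ⟨e, a, i, rfl⟩ := e
    refine Subtype.ext (funext fun x => ?_)
    have h1 := (harm a).2.2 i x
    rw [hv0 a, ← pval_dirDerivPoly] at h1
    simp only [dirDerivPoly, map_zero, smul_zero, Finset.sum_const_zero, pval_zero, vnn] at h1
    refine (mul_eq_zero.1 h1).resolve_right ?_
    rcases M.inner_normal_eq ne hne a i with h2 | h2 <;> rw [h2] <;> norm_num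

theorem existsUnique_isWGSolution (hd : 0 < d) (hΩ : IsBoundedDomain Ω)
    (hne : M.IsNormalField ne) {j : ℕ} (hk : 2 ≤ k)
    (hj : ∀ a, k + 2 * (M.elem a).n - 1 ≤ j) {f g φ : E d → ℝ}
    (hf : MemLp f 2 (volume.restrict Ω))
    (hg : MemLp g 2 ((surf d).restrict (frontier Ω)))
    (hφ : MemLp φ 2 ((surf d).restrict (frontier Ω))) :
    ∃! u : M.V k, M.IsWGSolution ne j f g φ u := by
  have := M.finiteDimensional_V (k := k)
  obtain ⟨u₀, hu₀⟩ := M.exists_boundary_lift (k := k) ne hΩ hne hg hφ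
  let F : M.V k →ₗ[ℝ] ℝ :=
    { toFun v := ∑ a, ∫ x in (M.elem a).carrier, f x * pval (M.v0 v a) x
      map_add' v v' := by
        have h := fun a => integral_add (M.integrableOn_carrier_mul hΩ hf a (M.v0 v a))
          (M.integrableOn_carrier_mul hΩ hf a (M.v0 v' a))
        simp only [v0_add, pval_add, mul_add, h, Finset.sum_add_distrib]
      map_smul' c v := by
        simp only [v0_smul, pval_smul, mul_left_comm _ c, integral_const_mul, ← Finset.mul_sum,
          RingHom.id_apply, smul_eq_mul] }
  let B : M.subspaceV0 (k := k) ne →ₗ[ℝ] M.subspaceV0 (k := k) ne →ₗ[ℝ] ℝ :=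
    (M.form ne j).domRestrict₁₂ _ _
  -- The correction to the lift solves the homogeneous-boundary problem with right-hand side `F -
  -- form u₀`.
  obtain ⟨w, hw, -⟩ := existsUnique_of_definite (W := M.subspaceV0 (k := k) ne) B
    (fun v hv => Subtype.ext (M.eq_zero_of_form_self ne hd hne hk hj v.2 hv))
    ((F - M.form ne j u₀).domRestrict _)
  refine ⟨u₀ + w.1, ⟨fun a i hfr => ?_, fun a i hfr => ?_, fun v hv => ?_⟩, fun u' hu' => ?_⟩
  · have h1 : M.vb (u₀ + w.1) (M.face a i) = M.vb u₀ (M.face a i) := by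
      funext x
      rw [vb_add, Pi.add_apply, (w.2 a i hfr).1, add_zero]
    rw [h1]
    exact (hu₀ a i hfr).1
  · have h1 : M.vnn ne (u₀ + w.1) a i = M.vnn ne u₀ a i := by
      funext x
      rw [vnn_add, Pi.add_apply, (w.2 a i hfr).2, add_zero]
    rw [h1]
    exact (hu₀ a i hfr).2
  · rw [← form_apply, map_add, LinearMap.add_apply]
    have h1 : M.form ne j w.1 v = F v - M.form ne j u₀ v := hw ⟨v, hv⟩
    rw [h1]
    exact add_sub_cancel _ _
  -- Projections are unique, so any solution has the boundary components of the lift.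
  · have hmem : u' - u₀ ∈ M.subspaceV0 ne := by
      intro a i hfr
      have h1 := (M.existsUnique_isL2Projection hg (M.face a i) hfr k).unique
        (hu'.dirichlet a i hfr) (hu₀ a i hfr).1
      have h2 := (M.existsUnique_isL2Projection hφ (M.face a i) hfr (k - 1)).unique
        (hu'.neumann a i hfr) (hu₀ a i hfr).2
      rw [sub_eq_add_neg, ← neg_one_smul ℝ u₀]
      refine ⟨fun x => ?_, fun x => ?_⟩
      · rw [vb_add, vb_smul, h1]
        simp
      · rw [vnn_add, vnn_smul, h2]
        simp
    have hzero : u' - u₀ - w.1 = 0 := by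
      have hV0 : u' - u₀ - w.1 ∈ M.subspaceV0 ne := Submodule.sub_mem _ hmem w.2
      refine M.eq_zero_of_form_self ne hd hne hk hj hV0 ?_
      have h1 : M.form ne j u' (u' - u₀ - w.1) = F (u' - u₀ - w.1) := hu'.equation _ hV0
      have h2 : M.form ne j w.1 (u' - u₀ - w.1) =
        F (u' - u₀ - w.1) - M.form ne j u₀ (u' - u₀ - w.1) := hw ⟨_, hV0⟩
      rw [LinearMap.map_sub₂, LinearMap.map_sub₂, h1, h2]
      ring
    rw [sub_eq_zero, sub_eq_iff_eq_add] at hzero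
    rw [hzero, add_comm]

end Mesh

end Solvability

end WG

end

theorem mainTheorem4 {d : ℕ} (hd : 2 ≤ d) {Ω : Set (WG.E d)} (hΩ : WG.IsBoundedDomain Ω)
    {ι : Type*} [Fintype ι] (M : WG.Mesh Ω ι)
    (ne : M.Face → WG.E d) (hne : M.IsNormalField ne)
    (k j : ℕ) (hk : 2 ≤ k) (hj : ∀ a, k + 2 * (M.elem a).n - 1 ≤ j)
    (f g φ : WG.E d → ℝ)
    (hf : MeasureTheory.MemLp f 2 (MeasureTheory.volume.restrict Ω))
    (hg : MeasureTheory.MemLp g 2 ((WG.surf d).restrict (frontier Ω)))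
    (hφ : MeasureTheory.MemLp φ 2 ((WG.surf d).restrict (frontier Ω))) :
    (∀ (v : M.V k) (a : ι), ∃! w : MvPolynomial (Fin d) ℝ, M.IsWeakLap ne j v a w) ∧
    ∃! u : M.V k, M.IsWGSolution ne j f g φ u := by
  have hd' : 0 < d := by omega
  exact ⟨fun v a => M.existsUnique_isWeakLap ne j v a,
    M.existsUnique_isWGSolution ne hd' hΩ hne hk hj hf hg hφ⟩
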